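/- **Conventions.** Manifolds are smooth, finite-dimensional, Hausdorff and second countable; all functions, forms, vector fields, sections and bundle maps are smooth. A 2-plectic manifold is a manifold $M$ with a 3-form $\omega$ that is closed and nondegenerate ($\iota_v\omega=0\Rightarrow v=0$ for $v\in T_xM$). A vector field $v$ is Hamiltonian if $d\alpha=-\iota_v\omega$ for some 1-form $\alpha$; Hamiltonian vector fields form a Lie algebra $\mathfrak X_{\mathrm{Ham}}(M)$. **Courant algebroids.** A Courant algebroid is a vector bundle $C\to M$ with a nondegenerate symmetric bilinear form $\langle\cdot,\cdot\rangle$, a bundle map $\rho:C\to TM$ and a skew-symmetric $\mathbb R$-bilinear bracket $[\cdot,\cdot]_C$ on $\Gamma(C)$ such that, with $D:C^\infty(M)\to\Gamma(C)$ given by $\langle Df,e\rangle=\rho(e)f$ and $$T(e_1,e_2,e_3)=\tfrac16\big(\langle[e_1,e_2]_C,e_3\rangle+\langle[e_3,e_1]_C,e_2\rangle+\langle[e_2,e_3]_C,e_1\rangle\big),$$ one has, for all sections $e_i$ and functions $f,g$: 1. $[e_1,[e_2,e_3]_C]_C-[[e_1,e_2]_C,e_3]_C-[e_2,[e_1,e_3]_C]_C=-DT(e_1,e_2,e_3)$;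 2. $\rho([e_1,e_2]_C)=[\rho(e_1),\rho(e_2)]$; 3. $[e_1,fe_2]_C=f[e_1,e_2]_C+(\rho(e_1)f)\,e_2-\tfrac12\langle e_1,e_2\rangle Df$; 4. $\langle Df,Dg\rangle=0$; 5. $\rho(e_1)\langle e_2,e_3\rangle=\langle[\![e_1,e_2]\!],e_3\rangle+\langle e_2,[\![e_1,e_3]\!]\rangle$, where $[\![e_1,e_2]\!]=[e_1,e_2]_C+\tfrac12D\langle e_1,e_2\rangle$. It is exact if $0\to T^*M\xrightarrow{\rho^*}C\xrightarrow{\rho}TM\to0$ is exact, where $\rho^*$ is the dual of $\rho$ followed by $C^*\cong C$. A splitting is a bundle map $s:TM\to C$ with $\rho\circ s=\mathrm{id}$ and $\langle s(v),s(w)\rangle=0$; its curvature 3-form is $\langle[s(v_1),s(v_2)]_C,s(v_3)\rangle$. **Lie 2-algebras.** A Lie 2-algebra is a 2-term complex $L_1\xrightarrow{d}L_0$ of real vector spaces with a skew-symmetric chain map $[\cdot,\cdot]:L\otimes L\to L$ and a skew-symmetric chain homotopy $J$ from $[x,[y,z]]$ to $[[x,y],z]+[y,[x,z]]$ such that $$\begin{aligned}&[x,J(y,z,w)]+J(x,[y,z],w)+J(x,z,[y,w])+[J(x,y,z),w]+[z,J(x,y,w)]\\&=J(x,y,[z,w])+J([x,y],z,w)+[y,J(x,z,w)]+J(y,[x,z],w)+J(y,z,[x,w]).\end{aligned}$$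 A morphism $L\to L'$ is a chain map $\phi$ with a skew-symmetric chain homotopy $\Phi$ from $\phi([x,y])$ to $[\phi(x),\phi(y)]'$ such that $$\begin{aligned}&\phi_1(J(x,y,z))-J'(\phi_0x,\phi_0y,\phi_0z)=\Phi(x,[y,z])-\Phi([x,y],z)-\Phi(y,[x,z])\\&\quad-[\Phi(x,y),\phi_0z]'+[\phi_0x,\Phi(y,z)]'-[\phi_0y,\Phi(x,z)]'.\end{aligned}$$ Here a chain homotopy $h$ from $f$ to $g$ satisfies $f-g=dh+hd$. A morphism is a quasi-isomorphism if it induces isomorphisms on homology. $L'$ is a central extension of $L''$ by $L$ if there are morphisms $L\to L'\to L''$ whose chain maps form a short exact sequence of complexes and $[\operatorname{im}(L\to L'),L']=0$. A Lie algebra $\mathfrak g$ is regarded as the trivial Lie 2-algebra $0\to\mathfrak g$, and $b\mathfrak u(1)$ is the complex $\mathbb R\to0$ with zero bracket and Jacobiator. **Statement.** Let $(M,\omega)$ be a connected, simply connected 2-plectic manifold, and let $C$ be the exact Courant algebroid associated to it, that is, an exact Courant algebroid over $M$ with a splitting $s:TM\to C$ whose curvature 3-form is $-\omega$. Let $\Gamma(C)^s\subset\Gamma(C)$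 be the space of sections $e$ preserving the splitting: $[\![e,s(v)]\!]=s([\rho(e),v])$ for all vector fields $v$. Let $L_\infty(C)^s$ be the Lie 2-algebra $C^\infty(M)\xrightarrow{D}\Gamma(C)^s$ with bracket $[e_1,e_2]=[e_1,e_2]_C$, $[e,f]=-[f,e]=\tfrac12\langle e,Df\rangle$, $[f,g]=0$, and Jacobiator $J=-T$. Then $L_\infty(C)^s$ is quasi-isomorphic to a central extension of the trivial Lie 2-algebra $\mathfrak X_{\mathrm{Ham}}(M)$ by $b\mathfrak u(1)$: there are a Lie 2-algebra $L'$ that is a central extension of $\mathfrak X_{\mathrm{Ham}}(M)$ by $b\mathfrak u(1)$ and a quasi-isomorphism $L_\infty(C)^s\to L'$. -/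

import Mathlib

open scoped Manifold ContDiff Bundle
open Bundle VectorField

set_option linter.unusedSectionVars false

noncomputable section

namespace TwoPlectic

/-! ### Vector fields and functions -/

section VectorFields

variable (E : Type*) [NormedAddCommGroup E] [NormedSpace ℝ E]
  (M : Type*) [TopologicalSpace M] [ChartedSpace E M]

/-- Smooth real functions on `M`. -/
abbrev SmoothFn : Type _ := C^∞⟮𝓘(ℝ, E), M; 𝓘(ℝ, ℝ), ℝ⟯

/-- Smooth vector fields on `M`. -/
abbrev VF [IsManifold 𝓘(ℝ, E) ∞ M] : Type _ :=
  ContMDiffSection 𝓘(ℝ, E) E ∞ (fun x : M => TangentSpace 𝓘(ℝ, E) x)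

variable {E M}

/-- The value at `x` of the differential of `f`. -/
def dAt (f : SmoothFn E M) (x : M) : TangentSpace 𝓘(ℝ, E) x →L[ℝ] ℝ :=
  mvfderiv 𝓘(ℝ, E) f x

lemma SmoothFn.mdiff (f : SmoothFn E M) (x : M) : MDifferentiableAt 𝓘(ℝ, E) 𝓘(ℝ, ℝ) f x :=
  f.contMDiff.mdifferentiable (by simp) x

lemma dAt_add (f g : SmoothFn E M) (x : M) : dAt (f + g) x = dAt f x + dAt g x := by
  unfold dAt
  rw [ContMDiffMap.coe_add]
  exact mvfderiv_add (f.mdiff x) (g.mdiff x)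

lemma dAt_mul (f g : SmoothFn E M) (x : M) :
    dAt (f * g) x = f x • dAt g x + g x • dAt f x := by
  unfold dAt
  rw [ContMDiffMap.coe_mul]
  exact mvfderiv_mul (f.mdiff x) (g.mdiff x)

lemma dAt_smul (c : ℝ) (f : SmoothFn E M) (x : M) : dAt (c • f) x = c • dAt f x := by
  have h := mvfderiv_smul (I := 𝓘(ℝ, E)) (a := fun _ : M => c) (g := f) (x := x)
    mdifferentiableAt_const (f.mdiff x)
  unfold dAt
  rw [ContMDiffMap.coe_smul]
  ext v
  have h' := congrArg (fun l => l v) h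
  have h0 : mvfderiv 𝓘(ℝ, E) (fun _ : M => c) x = 0 := mvfderiv_const c
  rw [h0] at h'
  have e : ((fun _ : M => c) • (f : M → ℝ)) = c • (f : M → ℝ) := by ext y; simp
  rw [e] at h'
  simpa using h'

variable [IsManifold 𝓘(ℝ, E) ∞ M]

/-- The action of a vector field on a function: `v(f) = df(v)`. -/
def VF.deriv (v : VF E M) (f : SmoothFn E M) : SmoothFn E M where
  val x := dAt f x (v x)
  property := by
    have h1 := f.contMDiff.contMDiff_tangentMap (m := ∞) (n := ∞) (by simp)
    have h2 := (contMDiff_snd_tangentBundle_modelSpace ℝ 𝓘(ℝ, ℝ) (n := ∞)).comp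
      (h1.comp v.contMDiff)
    exact h2

@[simp] lemma VF.deriv_apply (v : VF E M) (f : SmoothFn E M) (x : M) :
    v.deriv f x = dAt f x (v x) := rfl

variable [FiniteDimensional ℝ E]

instance : Bracket (VF E M) (VF E M) where
  bracket v w := ⟨mlieBracket 𝓘(ℝ, E) v w, by
    have := FiniteDimensional.complete ℝ E
    have : IsManifold 𝓘(ℝ, E) (minSmoothness ℝ 2) M := by
      simp only [minSmoothness_of_isRCLikeNormedField]; infer_instance
    have : IsManifold 𝓘(ℝ, E) ((((⊤ : ℕ∞)) : WithTop ℕ∞) + 1) M := by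
      simpa using (inferInstance : IsManifold 𝓘(ℝ, E) ∞ M)
    exact ContDiff.mlieBracket_vectorField (n := ⊤) (m := ⊤) v.contMDiff w.contMDiff (by simp)⟩

lemma VF.bracket_apply (v w : VF E M) (x : M) :
    ⁅v, w⁆ x = mlieBracket 𝓘(ℝ, E) v w x := rfl

lemma VF.bracket_add (u v w : VF E M) : ⁅u, v + w⁆ = ⁅u, v⁆ + ⁅u, w⁆ := by
  have := FiniteDimensional.complete ℝ E
  ext x
  exact mlieBracket_add_right v.mdifferentiableAt w.mdifferentiableAt

lemma VF.bracket_skew (u v : VF E M) : ⁅u, v⁆ = -⁅v, u⁆ := by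
  have := FiniteDimensional.complete ℝ E
  ext x
  exact mlieBracket_swap_apply

lemma VF.bracket_const_smul (c : ℝ) (u v : VF E M) : ⁅u, c • v⁆ = c • ⁅u, v⁆ := by
  have := FiniteDimensional.complete ℝ E
  ext x
  exact mlieBracket_const_smul_right v.mdifferentiableAt

instance : LieRing (VF E M) where
  add_lie u v w := by
    rw [VF.bracket_skew, VF.bracket_add, VF.bracket_skew u w, VF.bracket_skew v w]; abel
  lie_add u v w := VF.bracket_add u v w
  lie_self u := by
    ext x
    exact congrFun (mlieBracket_self (I := 𝓘(ℝ, E)) (V := u)) x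
  leibniz_lie u v w := by
    have := FiniteDimensional.complete ℝ E
    have h3 : IsManifold 𝓘(ℝ, E) (minSmoothness ℝ 3) M := by
      simp only [minSmoothness_of_isRCLikeNormedField]; infer_instance
    have aux (s : VF E M) : ContMDiff 𝓘(ℝ, E) 𝓘(ℝ, E).tangent (minSmoothness ℝ 2)
        (fun x => (⟨x, s x⟩ : TangentBundle 𝓘(ℝ, E) M)) :=
      s.contMDiff.of_le (by simp only [minSmoothness_of_isRCLikeNormedField]; exact ENat.LEInfty.out)
    ext x
    exact leibniz_identity_mlieBracket_apply (aux u x) (aux v x) (aux w x)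

instance : LieAlgebra ℝ (VF E M) where
  lie_smul c u v := VF.bracket_const_smul c u v

end VectorFields

/-! ### Sections of a vector bundle -/

section Sections

variable {E : Type*} [NormedAddCommGroup E] [NormedSpace ℝ E]
  {M : Type*} [TopologicalSpace M] [ChartedSpace E M]
  {F : Type*} [NormedAddCommGroup F] [NormedSpace ℝ F]
  {V : M → Type*} [TopologicalSpace (TotalSpace F V)]
  [∀ x, TopologicalSpace (V x)] [FiberBundle F V]
  [∀ x, AddCommGroup (V x)] [∀ x, Module ℝ (V x)] [VectorBundle ℝ F V]

variable (E F V) in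
/-- The space `Γ(V)` of smooth sections of the vector bundle `V → M`. -/
abbrev Sec : Type _ := ContMDiffSection 𝓘(ℝ, E) F ∞ V

/-- The product of a function and a section. -/
instance : SMul (SmoothFn E M) (Sec E F V) where
  smul f e := ⟨(f : M → ℝ) • (e : ∀ x, V x), f.contMDiff.smul_section e.contMDiff⟩

@[simp] lemma Sec.fsmul_apply (f : SmoothFn E M) (e : Sec E F V) (x : M) :
    (f • e) x = f x • e x := rfl

variable [FiniteDimensional ℝ E] [T2Space M] [IsManifold 𝓘(ℝ, E) ∞ M]

/-- Local smooth sections extend to global ones, after shrinking. -/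
lemma exists_sec_eventuallyEq {u : Set M} (hu : IsOpen u) {x : M} (hx : x ∈ u)
    (s : ∀ x, V x)
    (hs : ContMDiffOn 𝓘(ℝ, E) (𝓘(ℝ, E).prod 𝓘(ℝ, F)) ∞ (fun y => TotalSpace.mk' F y (s y)) u) :
    ∃ e : Sec E F V, ∀ᶠ y in nhds x, e y = s y := by
  obtain ⟨f, -, hf⟩ := (SmoothBumpFunction.nhds_basis_tsupport (I := 𝓘(ℝ, E)) x).mem_iff.1
    (hu.mem_nhds hx)
  refine ⟨⟨(f : M → ℝ) • s, ?_⟩, ?_⟩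
  · exact ContMDiffOn.smul_section_of_tsupport f.contMDiff.contMDiffOn hu hf hs
  · filter_upwards [f.eventuallyEq_one] with y hy
    change f y • s y = s y
    rw [hy]; simp

variable [ContMDiffVectorBundle ∞ F V 𝓘(ℝ, E)]

/-- Every vector of a fibre is the value of a global smooth section. -/
lemma exists_sec_apply_eq {x : M} (v : V x) : ∃ e : Sec E F V, e x = v := by
  obtain ⟨s, hs, h⟩ := FiberBundle.exists_contMDiffOn_extend (k := ∞) 𝓘(ℝ, E) F v
  obtain ⟨u, hus, hu, hx⟩ := mem_nhds_iff.1 hs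
  obtain ⟨e, he⟩ := exists_sec_eventuallyEq hu hx _ (h.mono hus)
  exact ⟨e, by rw [he.self_of_nhds]; simp⟩

end Sections

section Commutator

variable {E : Type*} [NormedAddCommGroup E] [NormedSpace ℝ E] [FiniteDimensional ℝ E]
  {M : Type*} [TopologicalSpace M] [ChartedSpace E M] [IsManifold 𝓘(ℝ, E) ∞ M]

lemma VF.deriv_add (v : VF E M) (f g : SmoothFn E M) :
    v.deriv (f + g) = v.deriv f + v.deriv g := by
  ext x; simp [dAt_add]

lemma VF.deriv_smul (v : VF E M) (c : ℝ) (f : SmoothFn E M) :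
    v.deriv (c • f) = c • v.deriv f := by
  ext x; simp [dAt_smul]

lemma VF.deriv_mul (v : VF E M) (f g : SmoothFn E M) :
    v.deriv (f * g) = f * v.deriv g + g * v.deriv f := by
  ext x; simp [dAt_mul]

lemma VF.lie_fsmul (u v : VF E M) (f : SmoothFn E M) :
    ⁅u, f • v⁆ = u.deriv f • v + f • ⁅u, v⁆ := by
  have := FiniteDimensional.complete ℝ E
  ext x
  exact mlieBracket_smul_right (f.mdiff x) v.mdifferentiableAt

lemma lie_deriv_aux {X : Type*} [AddCommGroup X] [Module ℝ X] {a b c p q r : ℝ}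
    {Z U W S T : X}
    (h : a • Z + p • U + (q • W + r • (S + T)) =
      (b • Z + r • S) + (c • Z + q • W + (p • U + r • T))) : (b - (a - c)) • Z = 0 := by
  linear_combination (norm := module) (-1 : ℝ) • h

/-- The Lie bracket of vector fields is the commutator of the derivations. -/
lemma VF.lie_deriv [T2Space M] (u v : VF E M) (f : SmoothFn E M) :
    (⁅u, v⁆ : VF E M).deriv f = u.deriv (v.deriv f) - v.deriv (u.deriv f) := by
  ext x
  rcases subsingleton_or_nontrivial E with h | h
  · have key (w : VF E M) (g : SmoothFn E M) : w.deriv g x = 0 := by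
      have : w x = 0 := Subsingleton.elim (α := E) _ _
      simp [this]
    simp [-VF.deriv_apply, key]
  · obtain ⟨z, hz⟩ := exists_ne (0 : E)
    obtain ⟨Z, hZ⟩ := exists_sec_apply_eq (E := E) (F := E)
      (V := fun x : M => TangentSpace 𝓘(ℝ, E) x) (x := x) z
    have hz' : (Z x : TangentSpace 𝓘(ℝ, E) x) ≠ 0 := by rw [hZ]; exact hz
    have hj := leibniz_lie u v (f • Z)
    have hj' := leibniz_lie u v Z
    simp only [VF.lie_fsmul, lie_add] at hj
    have h1 := congrArg (fun s : VF E M => s x) hj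
    have h2 := congrArg (fun s : VF E M => s x) hj'
    simp only [ContMDiffSection.coe_add, Pi.add_apply, Sec.fsmul_apply] at h1 h2
    have h3 : ((⁅u, v⁆ : VF E M).deriv f x - (u.deriv (v.deriv f) x - v.deriv (u.deriv f) x)) •
        Z x = 0 := by
      rw [h2] at h1
      exact lie_deriv_aux h1
    exact sub_eq_zero.1 ((smul_eq_zero.1 h3).resolve_right hz')

end Commutator

/-! ### Differential forms -/

section Forms

variable (E : Type*) [NormedAddCommGroup E] [NormedSpace ℝ E]
  (M : Type*) [TopologicalSpace M] [ChartedSpace E M] [IsManifold 𝓘(ℝ, E) ∞ M]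

/-- Smooth differential `k`-forms on `M`. Smoothness is expressed by: the form takes smooth values
on smooth vector fields. -/
@[ext] structure DiffForm (k : ℕ) where
  /-- the alternating form on each tangent space -/
  toFun : ∀ x : M, TangentSpace 𝓘(ℝ, E) x [⋀^Fin k]→ₗ[ℝ] ℝ
  smooth' : ∀ v : Fin k → VF E M,
    ContMDiff 𝓘(ℝ, E) 𝓘(ℝ, ℝ) ∞ (fun x => toFun x (fun i => v i x))

variable {E M}
variable {k : ℕ}

/-- The function `Ω(v₁, …, v_k)`. -/
def DiffForm.eval (Ω : DiffForm E M k) (v : Fin k → VF E M) : SmoothFn E M :=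
  ⟨fun x => Ω.toFun x (fun i => v i x), Ω.smooth' v⟩

lemma DiffForm.eval_apply (Ω : DiffForm E M k) (v : Fin k → VF E M) (x : M) :
    Ω.eval v x = Ω.toFun x (fun i => v i x) := rfl

/-- The interior product `ι_v Ω = Ω(v, ·, …, ·)`. -/
def DiffForm.interior (v : VF E M) (Ω : DiffForm E M (k + 1)) : DiffForm E M k where
  toFun x := (Ω.toFun x).curryLeft (v x)
  smooth' w := by
    convert! Ω.smooth' (Matrix.vecCons v w) using 2 with x
    simp only [AlternatingMap.curryLeft_apply_apply]
    congr 1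
    ext i
    refine Fin.cases ?_ (fun j => ?_) i <;> simp

lemma DiffForm.interior_eval (v : VF E M) (Ω : DiffForm E M (k + 1)) (w : Fin k → VF E M) :
    (Ω.interior v).eval w = Ω.eval (Matrix.vecCons v w) := by
  ext x
  simp only [DiffForm.eval_apply, DiffForm.interior, AlternatingMap.curryLeft_apply_apply]
  congr 1
  ext i
  refine Fin.cases ?_ (fun j => ?_) i <;> simp

variable [FiniteDimensional ℝ E]

/-- The exterior derivative of a form of degree `k + 1`, evaluated on vector fields
`v₀, …, v_{k+1}`:
`dΩ(v₀, …) = ∑ᵢ (-1)ⁱ vᵢ(Ω(…, v̂ᵢ, …)) + ∑_{a < b} (-1)^(a+b) Ω([v_a, v_b], …, v̂_a, …, v̂_b, …)`.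
The pair `a < b` is written as `(i, j + 1)` with `i ≤ j`, which explains the sign of the
second sum. -/
def DiffForm.d (Ω : DiffForm E M (k + 1)) (v : Fin (k + 2) → VF E M) : SmoothFn E M :=
  (∑ i : Fin (k + 2), (-1 : ℝ) ^ (i : ℕ) • (v i).deriv (Ω.eval (i.removeNth v))) -
    ∑ i : Fin (k + 1), ∑ j ∈ Finset.univ.filter (fun j : Fin (k + 1) => i ≤ j),
      (-1 : ℝ) ^ (i + j : ℕ) • Ω.eval
        (Matrix.vecCons ⁅v i.castSucc, v j.succ⁆ (j.removeNth (i.castSucc.removeNth v)))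

/-- The form `Ω` is closed: `dΩ = 0`. -/
def DiffForm.IsClosed (Ω : DiffForm E M (k + 1)) : Prop := ∀ v, Ω.d v = 0

/-- A 2-plectic structure: a closed nondegenerate 3-form. -/
structure IsTwoPlectic (Ω : DiffForm E M 3) : Prop where
  closed : Ω.IsClosed
  nondegenerate : ∀ (x : M) (v : TangentSpace 𝓘(ℝ, E) x),
    (Ω.toFun x).curryLeft v = 0 → v = 0

/-- `v` is the Hamiltonian vector field of the 1-form `α`: `dα = -ι_v Ω`. -/
def IsHamiltonianPair (Ω : DiffForm E M 3) (α : DiffForm E M 1) (v : VF E M) : Prop :=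
  ∀ u : Fin 2 → VF E M, α.d u = -(Ω.interior v).eval u

lemma DiffForm.d_one (α : DiffForm E M 1) (u v : VF E M) :
    α.d ![u, v] = u.deriv (α.eval ![v]) - v.deriv (α.eval ![u]) - α.eval ![⁅u, v⁆] := by
  have h0 : (0 : Fin 2).removeNth ![u, v] = ![v] := by ext i; fin_cases i; rfl
  have h1 : (1 : Fin 2).removeNth ![u, v] = ![u] := by ext i; fin_cases i; rfl
  have h2 (w : VF E M) (y : Fin 0 → VF E M) : Matrix.vecCons w y = ![w] := by
    ext i; fin_cases i; rfl
  have key : α.d ![u, v] =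
      (∑ i : Fin 2, (-1 : ℝ) ^ (i : ℕ) • (![u, v] i).deriv (α.eval (i.removeNth ![u, v]))) -
      ∑ i : Fin 1, ∑ j ∈ Finset.univ.filter (fun j : Fin 1 => i ≤ j),
        (-1 : ℝ) ^ (i + j : ℕ) • α.eval
          (Matrix.vecCons ⁅![u, v] i.castSucc, ![u, v] j.succ⁆
            (j.removeNth (i.castSucc.removeNth ![u, v]))) := rfl
  rw [key]
  simp only [Fin.sum_univ_two, Finset.sum_filter, Fin.sum_univ_one, h0, h1, h2]
  simp [sub_eq_add_neg]

lemma DiffForm.d_three (α : DiffForm E M 3) (a b c e : VF E M) :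
    α.d ![a, b, c, e] =
      a.deriv (α.eval ![b, c, e]) - b.deriv (α.eval ![a, c, e]) + c.deriv (α.eval ![a, b, e])
      - e.deriv (α.eval ![a, b, c])
      - α.eval ![⁅a, b⁆, c, e] + α.eval ![⁅a, c⁆, b, e] - α.eval ![⁅a, e⁆, b, c]
      - α.eval ![⁅b, c⁆, a, e] + α.eval ![⁅b, e⁆, a, c] - α.eval ![⁅c, e⁆, a, b] := by
  have h0 : (0 : Fin 4).removeNth ![a, b, c, e] = ![b, c, e] := by ext i; fin_cases i <;> rfl
  have h1 : (1 : Fin 4).removeNth ![a, b, c, e] = ![a, c, e] := by ext i; fin_cases i <;> rfl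
  have h2 : (2 : Fin 4).removeNth ![a, b, c, e] = ![a, b, e] := by ext i; fin_cases i <;> rfl
  have h3 : (3 : Fin 4).removeNth ![a, b, c, e] = ![a, b, c] := by ext i; fin_cases i <;> rfl
  have k0 (x y z : VF E M) : (0 : Fin 3).removeNth ![x, y, z] = ![y, z] := by
    ext i; fin_cases i <;> rfl
  have k1 (x y z : VF E M) : (1 : Fin 3).removeNth ![x, y, z] = ![x, z] := by
    ext i; fin_cases i <;> rfl
  have k2 (x y z : VF E M) : (2 : Fin 3).removeNth ![x, y, z] = ![x, y] := by
    ext i; fin_cases i <;> rfl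
  have c0 : (Fin.castSucc (0 : Fin 3)) = (0 : Fin 4) := rfl
  have c1 : (Fin.castSucc (1 : Fin 3)) = (1 : Fin 4) := rfl
  have c2 : (Fin.castSucc (2 : Fin 3)) = (2 : Fin 4) := rfl
  have s0 : (Fin.succ (0 : Fin 3)) = (1 : Fin 4) := rfl
  have s1 : (Fin.succ (1 : Fin 3)) = (2 : Fin 4) := rfl
  have s2 : (Fin.succ (2 : Fin 3)) = (3 : Fin 4) := rfl
  have l1 : ¬ ((1 : Fin 3) ≤ 0) := by decide
  have l2 : ¬ ((2 : Fin 3) ≤ 0) := by decide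
  have l3 : ¬ ((2 : Fin 3) ≤ 1) := by decide
  have l4 : ((1 : Fin 3) ≤ 2) := by decide
  have e2 : ((2 : Fin 3) : ℕ) = 2 := rfl
  have e3 : ((3 : Fin 4) : ℕ) = 3 := rfl
  have e4 : ((2 : Fin 4) : ℕ) = 2 := rfl
  have key : α.d ![a, b, c, e] =
      (∑ i : Fin 4, (-1 : ℝ) ^ (i : ℕ) • (![a, b, c, e] i).deriv (α.eval (i.removeNth ![a, b, c, e]))) -
      ∑ i : Fin 3, ∑ j ∈ Finset.univ.filter (fun j : Fin 3 => i ≤ j),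
        (-1 : ℝ) ^ (i + j : ℕ) • α.eval
          (Matrix.vecCons ⁅![a, b, c, e] i.castSucc, ![a, b, c, e] j.succ⁆
            (j.removeNth (i.castSucc.removeNth ![a, b, c, e]))) := rfl
  rw [key]
  simp only [Fin.sum_univ_four, Finset.sum_filter, Fin.sum_univ_three, h0, h1, h2, h3,
    c0, c1, c2, s0, s1, s2, k0, k1, k2, l1, l2, l3, l4, e2, e3, e4, Matrix.cons_val_zero,
    Matrix.cons_val_one, Matrix.cons_val, Fin.zero_le, le_refl, if_true, if_false,
    Fin.val_zero, Fin.val_one]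
  norm_num
  ring

end Forms

section Hamiltonian

variable {E : Type*} [NormedAddCommGroup E] [NormedSpace ℝ E]
  {M : Type*} [TopologicalSpace M] [ChartedSpace E M] [IsManifold 𝓘(ℝ, E) ∞ M]
  {k : ℕ}

instance : Zero (DiffForm E M k) := ⟨⟨fun _ => 0, fun _ => contMDiff_const⟩⟩

instance : Add (DiffForm E M k) :=
  ⟨fun α β => ⟨fun x => α.toFun x + β.toFun x, fun v => (α.smooth' v).add (β.smooth' v)⟩⟩

instance : SMul ℝ (DiffForm E M k) :=
  ⟨fun c α => ⟨fun x => c • α.toFun x, fun v =>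
    (contMDiff_const : ContMDiff 𝓘(ℝ, E) 𝓘(ℝ, ℝ) ∞ (fun _ : M => c)).smul (α.smooth' v)⟩⟩

instance : Neg (DiffForm E M k) :=
  ⟨fun α => ⟨fun x => -α.toFun x, fun v => (α.smooth' v).neg⟩⟩

lemma DiffForm.zero_eval (v : Fin k → VF E M) : (0 : DiffForm E M k).eval v = 0 := rfl

lemma DiffForm.add_eval (α β : DiffForm E M k) (v : Fin k → VF E M) :
    (α + β).eval v = α.eval v + β.eval v := rfl

lemma DiffForm.neg_eval (α : DiffForm E M k) (v : Fin k → VF E M) :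
    (-α).eval v = -α.eval v := rfl

lemma DiffForm.smul_eval (c : ℝ) (α : DiffForm E M k) (v : Fin k → VF E M) :
    (c • α).eval v = c • α.eval v := rfl

lemma DiffForm.eval_swap₀₁ (Ω : DiffForm E M 3) (a b c : VF E M) :
    Ω.eval ![a, b, c] = -Ω.eval ![b, a, c] := by
  ext x
  have h := (Ω.toFun x).map_swap (fun i => ![b, a, c] i x) (i := 0) (j := 1) (by decide)
  have e : (fun i => ![b, a, c] i x) ∘ ⇑(Equiv.swap (0 : Fin 3) 1) = fun i => ![a, b, c] i x := by
    ext i; fin_cases i <;> rfl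
  rw [e] at h
  simpa [DiffForm.eval_apply] using h

lemma DiffForm.eval_swap₁₂ (Ω : DiffForm E M 3) (a b c : VF E M) :
    Ω.eval ![a, b, c] = -Ω.eval ![a, c, b] := by
  ext x
  have h := (Ω.toFun x).map_swap (fun i => ![a, c, b] i x) (i := 1) (j := 2) (by decide)
  have e : (fun i => ![a, c, b] i x) ∘ ⇑(Equiv.swap (1 : Fin 3) 2) = fun i => ![a, b, c] i x := by
    ext i; fin_cases i <;> rfl
  rw [e] at h
  simpa [DiffForm.eval_apply] using h

lemma DiffForm.eval_add₀ (Ω : DiffForm E M (k + 1)) (a b : VF E M) (v : Fin k → VF E M) :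
    Ω.eval (Matrix.vecCons (a + b) v) = Ω.eval (Matrix.vecCons a v) +
      Ω.eval (Matrix.vecCons b v) := by
  simp only [← DiffForm.interior_eval]
  ext x
  change (Ω.toFun x).curryLeft ((a + b) x) _ = (Ω.toFun x).curryLeft (a x) _ +
    (Ω.toFun x).curryLeft (b x) _
  rw [ContMDiffSection.coe_add, Pi.add_apply, map_add]; rfl

lemma DiffForm.eval_smul₀ (Ω : DiffForm E M (k + 1)) (c : ℝ) (a : VF E M) (v : Fin k → VF E M) :
    Ω.eval (Matrix.vecCons (c • a) v) = c • Ω.eval (Matrix.vecCons a v) := by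
  simp only [← DiffForm.interior_eval]
  ext x
  change (Ω.toFun x).curryLeft ((c • a) x) _ = c • (Ω.toFun x).curryLeft (a x) _
  rw [ContMDiffSection.coe_smul, Pi.smul_apply, map_smul]; rfl

variable [FiniteDimensional ℝ E]

lemma isHamiltonianPair_iff {Ω : DiffForm E M 3} {α : DiffForm E M 1} {v : VF E M} :
    IsHamiltonianPair Ω α v ↔ ∀ a b : VF E M,
      Ω.eval ![v, a, b] = -(a.deriv (α.eval ![b]) - b.deriv (α.eval ![a]) - α.eval ![⁅a, b⁆]) := by
  constructor
  · intro h a b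
    have := h ![a, b]
    rw [DiffForm.d_one, DiffForm.interior_eval] at this
    rw [this, neg_neg]
  · intro h u
    obtain ⟨a, b, rfl⟩ : ∃ a b, u = ![a, b] := ⟨u 0, u 1, by ext i; fin_cases i <;> rfl⟩
    rw [DiffForm.d_one, DiffForm.interior_eval, h, neg_neg]

lemma VF.deriv_neg (v : VF E M) (f : SmoothFn E M) : v.deriv (-f) = -v.deriv f := by
  have := v.deriv_smul (-1) f
  simpa using this

lemma VF.deriv_sub (v : VF E M) (f g : SmoothFn E M) :
    v.deriv (f - g) = v.deriv f - v.deriv g := by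
  rw [sub_eq_add_neg, VF.deriv_add, VF.deriv_neg, ← sub_eq_add_neg]

lemma IsHamiltonianPair.closed [T2Space M] {Ω : DiffForm E M 3} {α : DiffForm E M 1} {v : VF E M}
    (h : IsHamiltonianPair Ω α v) (a b c : VF E M) :
    a.deriv (Ω.eval ![v, b, c]) - b.deriv (Ω.eval ![v, a, c]) + c.deriv (Ω.eval ![v, a, b])
      - Ω.eval ![v, ⁅a, b⁆, c] + Ω.eval ![v, ⁅a, c⁆, b] - Ω.eval ![v, ⁅b, c⁆, a] = 0 := by
  rw [isHamiltonianPair_iff] at h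
  simp only [h, VF.deriv_neg, VF.deriv_sub, VF.lie_deriv]
  have hj : α.eval ![⁅⁅a, b⁆, c⁆] = α.eval ![⁅⁅a, c⁆, b⁆] - α.eval ![⁅⁅b, c⁆, a⁆] := by
    have e : ⁅⁅a, c⁆, b⁆ = ⁅⁅a, b⁆, c⁆ + ⁅⁅b, c⁆, a⁆ := by
      rw [← lie_skew ⁅b, c⁆ a, leibniz_lie a b c, ← lie_skew b ⁅a, c⁆]; abel
    rw [e, DiffForm.eval_add₀]; ring
  rw [hj]
  ring

/-- The bracket `{α, β} = ι_{v_β} ι_{v_α} Ω` of Hamiltonian 1-forms is Hamiltonian, with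
Hamiltonian vector field `[v_α, v_β]`. -/
lemma IsHamiltonianPair.bracket [T2Space M] {Ω : DiffForm E M 3} (hΩ : Ω.IsClosed)
    {α β : DiffForm E M 1} {v w : VF E M}
    (hα : IsHamiltonianPair Ω α v) (hβ : IsHamiltonianPair Ω β w) :
    IsHamiltonianPair Ω ((Ω.interior v).interior w) ⁅v, w⁆ := by
  rw [isHamiltonianPair_iff]
  intro a b
  simp only [DiffForm.interior_eval]
  have h0 := hΩ ![v, w, a, b]
  rw [DiffForm.d_three] at h0
  have hf := hα.closed w a b
  have hg := hβ.closed v a b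
  have s1 := Ω.eval_swap₀₁ w v a
  have s2 := Ω.eval_swap₀₁ w v b
  have s3 := Ω.eval_swap₀₁ ⁅v, a⁆ w b
  have s4 := Ω.eval_swap₀₁ ⁅v, b⁆ w a
  have s5 := Ω.eval_swap₀₁ ⁅w, a⁆ v b
  have s6 := Ω.eval_swap₀₁ ⁅w, b⁆ v a
  have s7 := Ω.eval_swap₀₁ ⁅a, b⁆ v w
  have s8 := Ω.eval_swap₁₂ v ⁅a, b⁆ w
  have s9 := Ω.eval_swap₀₁ w ⁅a, b⁆ v
  have s10 := Ω.eval_swap₁₂ ⁅a, b⁆ w v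
  rw [s1, s2, VF.deriv_neg, VF.deriv_neg, s9, s10, s7, s8] at hg
  rw [s8] at hf
  rw [s3, s4, s5, s6, s7, s8] at h0
  linear_combination hg - hf - h0

/-- The Lie algebra `𝔛_Ham(M)` of Hamiltonian vector fields. -/
def hamVF [T2Space M] (Ω : DiffForm E M 3) (hΩ : IsTwoPlectic Ω) : LieSubalgebra ℝ (VF E M) where
  carrier := {v | ∃ α, IsHamiltonianPair Ω α v}
  zero_mem' := by
    refine ⟨0, ?_⟩
    rw [isHamiltonianPair_iff]
    intro a b
    have h := Ω.eval_smul₀ 0 (0 : VF E M) ![a, b]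
    have h' (v : VF E M) : v.deriv (0 : SmoothFn E M) = 0 := by
      have := v.deriv_smul 0 0
      simpa using this
    rw [zero_smul, zero_smul] at h
    rw [h]
    simp [DiffForm.zero_eval, h']
  add_mem' := by
    rintro v w ⟨α, hα⟩ ⟨β, hβ⟩
    refine ⟨α + β, ?_⟩
    rw [isHamiltonianPair_iff] at *
    intro a b
    rw [DiffForm.eval_add₀, hα, hβ]
    simp only [DiffForm.add_eval, VF.deriv_add]
    ring
  smul_mem' := by
    rintro c v ⟨α, hα⟩
    refine ⟨c • α, ?_⟩
    rw [isHamiltonianPair_iff] at *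
    intro a b
    rw [DiffForm.eval_smul₀, hα]
    simp only [DiffForm.smul_eval, VF.deriv_smul]
    module
  lie_mem' := by
    rintro v w ⟨α, hα⟩ ⟨β, hβ⟩
    exact ⟨_, hα.bracket hΩ.closed hβ⟩

lemma mem_hamVF [T2Space M] {Ω : DiffForm E M 3} {hΩ : IsTwoPlectic Ω} {v : VF E M} :
    v ∈ hamVF Ω hΩ ↔ ∃ α, IsHamiltonianPair Ω α v := Iff.rfl

end Hamiltonian

/-! ### Lie 2-algebras -/

section LieTwo

universe u v u' v' u'' v''

/-- A (semistrict) Lie 2-algebra: a 2-term complex `L1 → L0` of real vector spaces with a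
skew-symmetric bracket (a chain map) and a skew-symmetric Jacobiator (a chain homotopy from
`[x, [y, z]]` to `[[x, y], z] + [y, [x, z]]`) satisfying a coherence equation. The components of
the bracket are `[x, y] = bracket x y`, `[x, f] = act x f`, `[f, x] = -act x f` and `[f, g] = 0`,
for `x y : L0` and `f g : L1`. -/
structure Lie2Algebra where
  /-- chains of degree 0 -/
  L0 : Type u
  /-- chains of degree 1 -/
  L1 : Type v
  [acg0 : AddCommGroup L0]
  [acg1 : AddCommGroup L1]
  [mod0 : Module ℝ L0]
  [mod1 : Module ℝ L1]
  /-- the differential -/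
  d : L1 →ₗ[ℝ] L0
  /-- the bracket in degree 0 -/
  bracket : L0 →ₗ[ℝ] L0 →ₗ[ℝ] L0
  /-- the bracket in degree 1 -/
  act : L0 →ₗ[ℝ] L1 →ₗ[ℝ] L1
  /-- the Jacobiator -/
  jac : L0 →ₗ[ℝ] L0 →ₗ[ℝ] L0 →ₗ[ℝ] L1
  bracket_skew : ∀ x y, bracket x y = -bracket y x
  /-- the bracket is a chain map, degree 1: `d[x, f] = [x, df]` -/
  d_act : ∀ x f, d (act x f) = bracket x (d f)
  /-- the bracket is a chain map, degree 2: `[df, g] - [f, dg] = d[f, g] = 0` -/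
  act_d : ∀ f g, act (d f) g = -act (d g) f
  jac_skew₁ : ∀ x y z, jac x y z = -jac y x z
  jac_skew₂ : ∀ x y z, jac x y z = -jac x z y
  /-- the Jacobiator is a chain homotopy, degree 0 -/
  d_jac : ∀ x y z,
    bracket x (bracket y z) - (bracket (bracket x y) z + bracket y (bracket x z)) = d (jac x y z)
  /-- the Jacobiator is a chain homotopy, degree 1; the cases with the chain of degree 1 in
  another position follow by skew-symmetry -/
  jac_d : ∀ x y f,
    act x (act y f) - (act (bracket x y) f + act y (act x f)) = jac x y (d f)
  coherence : ∀ x y z w,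
    act x (jac y z w) + jac x (bracket y z) w + jac x z (bracket y w) + -act w (jac x y z)
        + act z (jac x y w)
      = jac x y (bracket z w) + jac (bracket x y) z w + act y (jac x z w) + jac y (bracket x z) w
        + jac y z (bracket x w)

attribute [instance] Lie2Algebra.acg0 Lie2Algebra.acg1 Lie2Algebra.mod0 Lie2Algebra.mod1

/-- A morphism of Lie 2-algebras: a chain map `(φ0, φ1)` and a skew-symmetric chain homotopy `Φ`
from `φ [x, y]` to `[φ x, φ y]` satisfying a coherence equation. -/
structure Lie2Hom (L : Lie2Algebra.{u, v}) (L' : Lie2Algebra.{u', v'}) where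
  φ0 : L.L0 →ₗ[ℝ] L'.L0
  φ1 : L.L1 →ₗ[ℝ] L'.L1
  Φ : L.L0 →ₗ[ℝ] L.L0 →ₗ[ℝ] L'.L1
  comm : ∀ f, L'.d (φ1 f) = φ0 (L.d f)
  skew : ∀ x y, Φ x y = -Φ y x
  /-- chain homotopy, degree 0 -/
  d_htpy : ∀ x y, φ0 (L.bracket x y) - L'.bracket (φ0 x) (φ0 y) = L'.d (Φ x y)
  /-- chain homotopy, degree 1 -/
  htpy_d : ∀ x f, φ1 (L.act x f) - L'.act (φ0 x) (φ1 f) = Φ x (L.d f)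
  coherence : ∀ x y z,
    φ1 (L.jac x y z) - L'.jac (φ0 x) (φ0 y) (φ0 z) =
      Φ x (L.bracket y z) - Φ (L.bracket x y) z - Φ y (L.bracket x z)
        - -L'.act (φ0 z) (Φ x y) + L'.act (φ0 x) (Φ y z) - L'.act (φ0 y) (Φ x z)

namespace Lie2Hom

variable {L : Lie2Algebra.{u, v}} {L' : Lie2Algebra.{u', v'}}

/-- The map induced on the homology in degree 1, `H₁ = ker d`. -/
def mapH1 (φ : Lie2Hom L L') : LinearMap.ker L.d →ₗ[ℝ] LinearMap.ker L'.d :=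
  φ.φ1.restrict (fun f hf => by
    rw [LinearMap.mem_ker] at *
    rw [φ.comm, hf, map_zero])

/-- The map induced on the homology in degree 0, `H₀ = L0 / d(L1)`. -/
def mapH0 (φ : Lie2Hom L L') : (L.L0 ⧸ LinearMap.range L.d) →ₗ[ℝ] (L'.L0 ⧸ LinearMap.range L'.d) :=
  Submodule.mapQ _ _ φ.φ0 (by
    rintro _ ⟨f, rfl⟩
    exact ⟨φ.φ1 f, φ.comm f⟩)

/-- The morphism induces isomorphisms on homology. -/
def IsQuasiIso (φ : Lie2Hom L L') : Prop :=
  Function.Bijective φ.mapH1 ∧ Function.Bijective φ.mapH0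

end Lie2Hom

/-- `L` is quasi-isomorphic to `L'`: there is a quasi-isomorphism from `L` to `L'`. -/
def QuasiIsomorphic (L : Lie2Algebra.{u, v}) (L' : Lie2Algebra.{u', v'}) : Prop :=
  ∃ φ : Lie2Hom L L', φ.IsQuasiIso

/-- `L'` is a strict central extension of `L''` by `L`: there are morphisms `L → L' → L''` whose
underlying chain maps form a short exact sequence of complexes, and the bracket of the image of
`L` with `L'` vanishes (in all degrees). -/
def IsCentralExtension (L : Lie2Algebra.{u, v}) (L' : Lie2Algebra.{u', v'})
    (L'' : Lie2Algebra.{u'', v''}) : Prop :=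
  ∃ (φ : Lie2Hom L L') (ψ : Lie2Hom L' L''),
    (Function.Injective φ.φ0 ∧ Function.Exact φ.φ0 ψ.φ0 ∧ Function.Surjective ψ.φ0) ∧
    (Function.Injective φ.φ1 ∧ Function.Exact φ.φ1 ψ.φ1 ∧ Function.Surjective ψ.φ1) ∧
    (∀ a x, L'.bracket (φ.φ0 a) x = 0) ∧
    (∀ a f, L'.act (φ.φ0 a) f = 0) ∧
    (∀ x b, L'.act x (φ.φ1 b) = 0)

/-- The trivial Lie 2-algebra `0 → 𝔤` of a Lie algebra `𝔤`. -/
def Lie2Algebra.trivial (𝔤 : Type u) [LieRing 𝔤] [LieAlgebra ℝ 𝔤] : Lie2Algebra.{u, 0} where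
  L0 := 𝔤
  L1 := PUnit
  d := 0
  bracket := (LieModule.toEnd ℝ 𝔤 𝔤 : 𝔤 →ₗ[ℝ] Module.End ℝ 𝔤)
  act := 0
  jac := 0
  bracket_skew x y := by simp
  d_act _ _ := by simp
  act_d _ _ := by simp
  jac_skew₁ _ _ _ := by simp
  jac_skew₂ _ _ _ := by simp
  d_jac x y z := by simp
  jac_d _ _ _ := by simp
  coherence _ _ _ _ := by simp

/-- The abelian Lie 2-algebra of a 2-term complex. -/
def Lie2Algebra.abelian {A : Type u} {B : Type v} [AddCommGroup A] [AddCommGroup B] [Module ℝ A]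
    [Module ℝ B] (δ : B →ₗ[ℝ] A) : Lie2Algebra.{u, v} where
  L0 := A
  L1 := B
  d := δ
  bracket := 0
  act := 0
  jac := 0
  bracket_skew _ _ := by simp
  d_act _ _ := by simp
  act_d _ _ := by simp
  jac_skew₁ _ _ _ := by simp
  jac_skew₂ _ _ _ := by simp
  d_jac _ _ _ := by simp
  jac_d _ _ _ := by simp
  coherence _ _ _ _ := by simp

/-- The abelian Lie 2-algebra `b𝔲(1)`, with underlying complex `ℝ → 0`. -/
def bu1 : Lie2Algebra.{0, 0} := Lie2Algebra.abelian (0 : ℝ →ₗ[ℝ] PUnit.{1})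

/-- The Lie 2-subalgebra of `L` with the same chains of degree 1, and with the chains of degree 0
in a subspace `S` which contains the image of `d` and is closed under the bracket. -/
def Lie2Algebra.sub (L : Lie2Algebra.{u, v}) (S : Submodule ℝ L.L0) (hd : ∀ f, L.d f ∈ S)
    (hb : ∀ x ∈ S, ∀ y ∈ S, L.bracket x y ∈ S) : Lie2Algebra.{u, v} where
  L0 := S
  L1 := L.L1
  d := L.d.codRestrict S hd
  bracket := LinearMap.mk₂ ℝ (fun x y : S => (⟨L.bracket x y, hb x x.2 y y.2⟩ : S))
    (fun _ _ _ => by ext; simp) (fun _ _ _ => by ext; simp)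
    (fun _ _ _ => by ext; simp) (fun _ _ _ => by ext; simp)
  act := L.act.comp S.subtype
  jac := ((LinearMap.lcomp ℝ (S →ₗ[ℝ] L.L1) S.subtype).comp
    ((LinearMap.llcomp ℝ L.L0 (L.L0 →ₗ[ℝ] L.L1) (S →ₗ[ℝ] L.L1)
      (LinearMap.lcomp ℝ L.L1 S.subtype)).comp L.jac)).comp S.subtype
  bracket_skew x y := Subtype.ext (L.bracket_skew x y)
  d_act x f := Subtype.ext (L.d_act x f)
  act_d f g := L.act_d f g
  jac_skew₁ x y z := L.jac_skew₁ x y z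
  jac_skew₂ x y z := L.jac_skew₂ x y z
  d_jac x y z := Subtype.ext (L.d_jac x y z)
  jac_d x y f := L.jac_d x y f
  coherence x y z w := L.coherence x y z w

end LieTwo

/-! ### Courant algebroids -/

section Det

variable {E : Type*} [NormedAddCommGroup E] [NormedSpace ℝ E]
  {M : Type*} [TopologicalSpace M] [ChartedSpace E M]

lemma contMDiffAt_det {ι : Type*} [Fintype ι] [DecidableEq ι] {A : M → Matrix ι ι ℝ} {x : M}
    (h : ∀ i j, ContMDiffAt 𝓘(ℝ, E) 𝓘(ℝ, ℝ) ∞ (fun y => A y i j) x) :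
    ContMDiffAt 𝓘(ℝ, E) 𝓘(ℝ, ℝ) ∞ (fun y => (A y).det) x := by
  simp only [Matrix.det_apply']
  refine ContMDiffAt.sum fun σ _ => ?_
  refine ContMDiffAt.mul contMDiffAt_const ?_
  exact ContMDiffAt.prod fun i _ => h _ _

end Det

section Courant

variable {E : Type*} [NormedAddCommGroup E] [NormedSpace ℝ E]
  {M : Type*} [TopologicalSpace M] [ChartedSpace E M] [IsManifold 𝓘(ℝ, E) ∞ M]
  {F : Type*} [NormedAddCommGroup F] [NormedSpace ℝ F]
  {V : M → Type*} [TopologicalSpace (TotalSpace F V)]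
  [∀ x, TopologicalSpace (V x)] [FiberBundle F V]
  [∀ x, AddCommGroup (V x)] [∀ x, Module ℝ (V x)] [VectorBundle ℝ F V]

variable (E F V) in
/-- A vector bundle `V → M` with a smooth nondegenerate symmetric bilinear form and a smooth bundle
map `anchor : V → TM`. Smoothness is tested on smooth sections. -/
structure PreCourant where
  /-- the bilinear form -/
  pairing : ∀ x : M, LinearMap.BilinForm ℝ (V x)
  pairing_symm : ∀ (x : M) (a b : V x), pairing x a b = pairing x b a
  pairing_nondegenerate : ∀ x : M, (pairing x).Nondegenerate
  pairing_smooth : ∀ e₁ e₂ : Sec E F V,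
    ContMDiff 𝓘(ℝ, E) 𝓘(ℝ, ℝ) ∞ (fun x => pairing x (e₁ x) (e₂ x))
  /-- the anchor -/
  anchor : ∀ x : M, V x →ₗ[ℝ] TangentSpace 𝓘(ℝ, E) x
  anchor_smooth : ∀ e : Sec E F V, ContMDiff 𝓘(ℝ, E) (𝓘(ℝ, E).prod 𝓘(ℝ, E)) ∞
    (fun x => TotalSpace.mk' E (E := fun y : M => TangentSpace 𝓘(ℝ, E) y) x (anchor x (e x)))

namespace PreCourant

variable (C : PreCourant E F V)

/-- The function `⟨e₁, e₂⟩`. -/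
def inner (e₁ e₂ : Sec E F V) : SmoothFn E M := ⟨_, C.pairing_smooth e₁ e₂⟩

/-- The vector field `ρ(e)`. -/
def rho (e : Sec E F V) : VF E M := ⟨_, C.anchor_smooth e⟩

@[simp] lemma inner_apply (e₁ e₂ : Sec E F V) (x : M) :
    C.inner e₁ e₂ x = C.pairing x (e₁ x) (e₂ x) := rfl

@[simp] lemma rho_apply (e : Sec E F V) (x : M) : C.rho e x = C.anchor x (e x) := rfl

lemma finiteDimensional_fibre [FiniteDimensional ℝ F] (x : M) : FiniteDimensional ℝ (V x) :=
  ((trivializationAt F V x).linearEquivAt ℝ x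
    (FiberBundle.mem_baseSet_trivializationAt' x)).symm.finiteDimensional

/-- The fibre at `x` of the dual `ρ^* : T^*M → V^* ≃ V` of the anchor, where `V^*` is identified
with `V` by the bilinear form. -/
def coanchor [FiniteDimensional ℝ F] (x : M) :
    Module.Dual ℝ (TangentSpace 𝓘(ℝ, E) x) →ₗ[ℝ] V x :=
  haveI : FiniteDimensional ℝ (V x) := finiteDimensional_fibre (F := F) x
  ((C.pairing x).toDual (C.pairing_nondegenerate x)).symm.toLinearMap ∘ₗ (C.anchor x).dualMap

lemma pairing_coanchor [FiniteDimensional ℝ F] (x : M)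
    (ξ : Module.Dual ℝ (TangentSpace 𝓘(ℝ, E) x)) (a : V x) :
    C.pairing x (C.coanchor x ξ) a = ξ (C.anchor x a) := by
  have : FiniteDimensional ℝ (V x) := finiteDimensional_fibre (F := F) x
  simp [coanchor]

/-- Exactness of `0 → T^*M → V → TM → 0`. -/
def IsExact [FiniteDimensional ℝ F] : Prop :=
  ∀ x, Function.Injective (C.coanchor x) ∧ Function.Exact (C.coanchor x) (C.anchor x) ∧
    Function.Surjective (C.anchor x)

variable [FiniteDimensional ℝ E] [T2Space M] [ContMDiffVectorBundle ∞ F V 𝓘(ℝ, E)]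

lemma sec_ext_of_inner {e e' : Sec E F V} (h : ∀ a, C.inner e a = C.inner e' a) : e = e' := by
  ext x
  have : e x - e' x = 0 := by
    refine (C.pairing_nondegenerate x).1 _ fun v => ?_
    obtain ⟨a, rfl⟩ := exists_sec_apply_eq (E := E) (F := F) v
    have := congrArg (fun f : SmoothFn E M => f x) (h a)
    simp only [inner_apply] at this
    rw [map_sub, LinearMap.sub_apply, this, sub_self]
  exact sub_eq_zero.1 this

/-- A section is smooth as soon as its pairings with smooth sections are smooth. -/
lemma contMDiff_of_pairing [FiniteDimensional ℝ F] (s : ∀ x, V x)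
    (hs : ∀ e : Sec E F V, ContMDiff 𝓘(ℝ, E) 𝓘(ℝ, ℝ) ∞ (fun x => C.pairing x (s x) (e x))) :
    ContMDiff 𝓘(ℝ, E) (𝓘(ℝ, E).prod 𝓘(ℝ, F)) ∞ (fun x => TotalSpace.mk' F x (s x)) := by
  classical
  intro x
  set t := trivializationAt F V x
  have hx : x ∈ t.baseSet := FiberBundle.mem_baseSet_trivializationAt' x
  let b := Module.finBasis ℝ F
  have hfr := fun i => t.contMDiffOn_localFrame_baseSet (I := 𝓘(ℝ, E)) ∞ b i
  choose g hg using fun i => exists_sec_eventuallyEq t.open_baseSet hx _ (hfr i)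
  refine (contMDiffAt_iff_localFrameCoeff (I := 𝓘(ℝ, E)) b hx).2 fun i => ?_
  let A : M → Matrix _ _ ℝ := fun y => Matrix.of fun j i => C.pairing y (g i y) (g j y)
  let h : M → _ → ℝ := fun y j => C.pairing y (s y) (g j y)
  have hA : ContMDiffAt 𝓘(ℝ, E) 𝓘(ℝ, ℝ) ∞ (fun y => (A y).det) x :=
    contMDiffAt_det fun j i => (C.pairing_smooth (g i) (g j)) x
  have hB : ContMDiffAt 𝓘(ℝ, E) 𝓘(ℝ, ℝ) ∞ (fun y => ((A y).updateCol i (h y)).det) x := by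
    refine contMDiffAt_det fun j i' => ?_
    by_cases hi : i' = i
    · subst hi
      simpa using hs (g j) x
    · have e : (fun y => (A y).updateCol i (h y) j i') =
          fun y => C.pairing y (g i' y) (g j y) := by
        ext y
        simp only [Matrix.updateCol_apply, hi, if_false]
        rfl
      rw [e]
      exact (C.pairing_smooth (g i') (g j)) x
  have hev : ∀ᶠ y in nhds x, y ∈ t.baseSet ∧ ∀ j, g j y = t.localFrame b j y :=
    (t.open_baseSet.eventually_mem hx).and (Filter.eventually_all.2 hg)
  have hc : ∀ y, (y ∈ t.baseSet ∧ ∀ j, g j y = t.localFrame b j y) →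
      (A y).mulVec (fun i => t.localFrameCoeff 𝓘(ℝ, E) b i y (s y)) = h y := by
    rintro y ⟨hy, hgy⟩
    ext j
    have := t.eq_sum_localFrameCoeff_smul (I := 𝓘(ℝ, E)) (b := b) (s := s) hy
    simp only [h]
    conv_rhs => rw [this]
    simp only [map_sum, map_smul, LinearMap.sum_apply, LinearMap.smul_apply, smul_eq_mul]
    simp only [Matrix.mulVec, dotProduct, A, Matrix.of_apply, hgy]
    exact Finset.sum_congr rfl fun _ _ => mul_comm _ _
  have hdet : (A x).det ≠ 0 := by
    obtain ⟨-, hgx⟩ := hev.self_of_nhds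
    have hbas : ∀ j, g j x = t.basisAt b hx j := fun j => by
      rw [hgx j]; simp [hx]
    have := (LinearMap.BilinForm.nondegenerate_iff_det_ne_zero (t.basisAt b hx)).1
      (C.pairing_nondegenerate x)
    convert this using 1
    rw [← Matrix.det_transpose]
    congr 1
    ext i j
    simp [A, hbas, LinearMap.BilinForm.toMatrix_apply]
  have hinv := (hB.mul (hA.inv₀ hdet))
  refine hinv.congr_of_eventuallyEq ?_
  have hne : ∀ᶠ y in nhds x, (A y).det ≠ 0 := hA.continuousAt.eventually_ne hdet
  filter_upwards [hev, hne] with y hy hy'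
  have h1 := Matrix.cramer_eq_adjugate_mulVec (A y) (h y)
  have h2 := congrFun h1 i
  rw [Matrix.cramer_apply, ← hc y hy, Matrix.mulVec_mulVec, Matrix.adjugate_mul,
    Matrix.smul_mulVec, Matrix.one_mulVec] at h2
  simp only [Pi.mul_apply, LinearMap.piApply]
  rw [hc y hy] at h2
  rw [h2]
  simp only [Pi.smul_apply, smul_eq_mul]
  change t.localFrameCoeff 𝓘(ℝ, E) b i y (s y) = _
  field_simp

variable [FiniteDimensional ℝ F]

/-- The map `D = ρ^* d : C^∞(M) → Γ(V)`, characterised by `⟨D f, e⟩ = ρ(e) f`. -/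
def D (f : SmoothFn E M) : Sec E F V where
  toFun x := C.coanchor x (dAt f x).toLinearMap
  contMDiff_toFun := by
    refine C.contMDiff_of_pairing _ fun e => ?_
    simp only [pairing_coanchor]
    exact ((C.rho e).deriv f).contMDiff

lemma inner_D (f : SmoothFn E M) (e : Sec E F V) : C.inner (C.D f) e = (C.rho e).deriv f := by
  ext x
  exact C.pairing_coanchor x _ _

end PreCourant

end Courant

section CourantAlgebroid

variable {E : Type*} [NormedAddCommGroup E] [NormedSpace ℝ E] [FiniteDimensional ℝ E]
  {M : Type*} [TopologicalSpace M] [T2Space M] [ChartedSpace E M] [IsManifold 𝓘(ℝ, E) ∞ M]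
  {F : Type*} [NormedAddCommGroup F] [NormedSpace ℝ F] [FiniteDimensional ℝ F]
  {V : M → Type*} [TopologicalSpace (TotalSpace F V)]
  [∀ x, TopologicalSpace (V x)] [FiberBundle F V]
  [∀ x, AddCommGroup (V x)] [∀ x, Module ℝ (V x)] [VectorBundle ℝ F V]
  [ContMDiffVectorBundle ∞ F V 𝓘(ℝ, E)]

/-- `T(e₁, e₂, e₃) = 1/6 (⟨[e₁, e₂], e₃⟩ + ⟨[e₃, e₁], e₂⟩ + ⟨[e₂, e₃], e₁⟩)`. -/
def PreCourant.T (C : PreCourant E F V) (br : Sec E F V →ₗ[ℝ] Sec E F V →ₗ[ℝ] Sec E F V)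
    (e₁ e₂ e₃ : Sec E F V) : SmoothFn E M :=
  (1 / 6 : ℝ) • (C.inner (br e₁ e₂) e₃ + C.inner (br e₃ e₁) e₂ + C.inner (br e₂ e₃) e₁)

variable (E F V) in
/-- A Courant algebroid, with skew-symmetric bracket on sections. -/
structure CourantAlgebroid extends PreCourant E F V where
  /-- the bracket of sections -/
  bracket : Sec E F V →ₗ[ℝ] Sec E F V →ₗ[ℝ] Sec E F V
  bracket_skew : ∀ e₁ e₂, bracket e₁ e₂ = -bracket e₂ e₁
  jacobi : ∀ e₁ e₂ e₃, bracket e₁ (bracket e₂ e₃) - bracket (bracket e₁ e₂) e₃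
    - bracket e₂ (bracket e₁ e₃) = -toPreCourant.D (toPreCourant.T bracket e₁ e₂ e₃)
  rho_bracket : ∀ e₁ e₂, toPreCourant.rho (bracket e₁ e₂) =
    ⁅toPreCourant.rho e₁, toPreCourant.rho e₂⁆
  leibniz : ∀ (e₁ e₂ : Sec E F V) (f : SmoothFn E M), bracket e₁ (f • e₂) =
    f • bracket e₁ e₂ + (toPreCourant.rho e₁).deriv f • e₂
      - ((1 / 2 : ℝ) • toPreCourant.inner e₁ e₂) • toPreCourant.D f
  inner_D_D : ∀ f g : SmoothFn E M, toPreCourant.inner (toPreCourant.D f) (toPreCourant.D g) = 0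
  invariance : ∀ e₁ e₂ e₃ : Sec E F V,
    (toPreCourant.rho e₁).deriv (toPreCourant.inner e₂ e₃) =
      toPreCourant.inner
        (bracket e₁ e₂ + (1 / 2 : ℝ) • toPreCourant.D (toPreCourant.inner e₁ e₂)) e₃ +
      toPreCourant.inner e₂
        (bracket e₁ e₃ + (1 / 2 : ℝ) • toPreCourant.D (toPreCourant.inner e₁ e₃))

namespace PreCourant

variable (C : PreCourant E F V)

lemma inner_symm (a b : Sec E F V) : C.inner a b = C.inner b a := by
  ext x; exact C.pairing_symm x _ _

lemma pair_add_left (a b c : Sec E F V) : C.inner (a + b) c = C.inner a c + C.inner b c := by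
  ext x; simp

lemma pair_add_right (a b c : Sec E F V) : C.inner a (b + c) = C.inner a b + C.inner a c := by
  ext x; simp

lemma pair_smul_left (r : ℝ) (a c : Sec E F V) : C.inner (r • a) c = r • C.inner a c := by
  ext x; simp

lemma pair_smul_right (r : ℝ) (a c : Sec E F V) : C.inner a (r • c) = r • C.inner a c := by
  ext x; simp

lemma pair_neg_left (a c : Sec E F V) : C.inner (-a) c = -C.inner a c := by
  ext x; simp

lemma pair_neg_right (a c : Sec E F V) : C.inner a (-c) = -C.inner a c := by
  ext x; simp

lemma rho_add (a b : Sec E F V) : C.rho (a + b) = C.rho a + C.rho b := by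
  ext x; simp

lemma rho_smul (r : ℝ) (a : Sec E F V) : C.rho (r • a) = r • C.rho a := by
  ext x; simp

lemma D_add (f g : SmoothFn E M) : C.D (f + g) = C.D f + C.D g := by
  apply C.sec_ext_of_inner; intro a
  simp only [pair_add_left, inner_D, VF.deriv_add]

lemma D_smul (r : ℝ) (f : SmoothFn E M) : C.D (r • f) = r • C.D f := by
  apply C.sec_ext_of_inner; intro a
  simp only [pair_smul_left, inner_D, VF.deriv_smul]

lemma D_neg (f : SmoothFn E M) : C.D (-f) = -C.D f := by
  simpa using C.D_smul (-1) f

lemma inner_D' (f : SmoothFn E M) (e : Sec E F V) : C.inner e (C.D f) = (C.rho e).deriv f := by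
  rw [inner_symm, inner_D]

end PreCourant

namespace CourantAlgebroid

open PreCourant

variable (C : CourantAlgebroid E F V)

/-- The Dorfman bracket `⟦e₁, e₂⟧ = [e₁, e₂] + 1/2 D⟨e₁, e₂⟩`. -/
def dorfman (e₁ e₂ : Sec E F V) : Sec E F V :=
  C.bracket e₁ e₂ + (1 / 2 : ℝ) • C.D (C.inner e₁ e₂)



variable (a b c e x y z w : Sec E F V) (f g : SmoothFn E M)

lemma inner_symm' : C.inner a b = C.inner b a := C.toPreCourant.inner_symm a b

lemma dorfman_add_symm : C.dorfman a b + C.dorfman b a = C.D (C.inner a b) := by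
  unfold dorfman
  rw [C.bracket_skew b a, C.inner_symm' b a]
  module

lemma rho_D_deriv : (C.rho (C.D f)).deriv g = 0 := by
  rw [← inner_D, C.inner_symm', C.inner_D_D]

lemma rho_deriv_add : (C.rho (a + b)).deriv f = (C.rho a).deriv f + (C.rho b).deriv f := by
  rw [rho_add]; ext; simp

lemma rho_deriv_smul (r : ℝ) : (C.rho (r • a)).deriv f = r • (C.rho a).deriv f := by
  rw [rho_smul]; ext; simp

lemma rho_dorfman_deriv : (C.rho (C.dorfman a b)).deriv f =
    (C.rho a).deriv ((C.rho b).deriv f) - (C.rho b).deriv ((C.rho a).deriv f) := by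
  unfold dorfman
  rw [rho_deriv_add, rho_deriv_smul, rho_D_deriv, smul_zero, add_zero, C.rho_bracket,
    VF.lie_deriv]

lemma invariance' : (C.rho a).deriv (C.inner b c) =
    C.inner (C.dorfman a b) c + C.inner b (C.dorfman a c) := C.invariance a b c

lemma dorfman_D : C.dorfman e (C.D f) = C.D ((C.rho e).deriv f) := by
  apply C.sec_ext_of_inner
  intro a
  have h := C.invariance' e (C.D f) a
  rw [inner_D, inner_D, rho_dorfman_deriv] at h
  rw [inner_D]
  linear_combination -h

lemma D_dorfman : C.dorfman (C.D f) e = 0 := by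
  have h := C.dorfman_add_symm (C.D f) e
  rw [dorfman_D, inner_D] at h
  simpa using h

lemma bracket_D : C.bracket e (C.D f) = (1 / 2 : ℝ) • C.D ((C.rho e).deriv f) := by
  have h := C.dorfman_D e f
  unfold dorfman at h
  rw [inner_D'] at h
  linear_combination (norm := module) h

lemma bracket_eq : C.bracket a b = C.dorfman a b - (1 / 2 : ℝ) • C.D (C.inner a b) := by
  unfold dorfman; module

end CourantAlgebroid
end CourantAlgebroid

section CourantLie

variable {E : Type*} [NormedAddCommGroup E] [NormedSpace ℝ E] [FiniteDimensional ℝ E]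
  {M : Type*} [TopologicalSpace M] [T2Space M] [ChartedSpace E M] [IsManifold 𝓘(ℝ, E) ∞ M]
  {F : Type*} [NormedAddCommGroup F] [NormedSpace ℝ F] [FiniteDimensional ℝ F]
  {V : M → Type*} [TopologicalSpace (TotalSpace F V)]
  [∀ x, TopologicalSpace (V x)] [FiberBundle F V]
  [∀ x, AddCommGroup (V x)] [∀ x, Module ℝ (V x)] [VectorBundle ℝ F V]
  [ContMDiffVectorBundle ∞ F V 𝓘(ℝ, E)]

namespace CourantAlgebroid

open PreCourant

variable (C : CourantAlgebroid E F V)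
variable (a b c e x y z w : Sec E F V) (f g : SmoothFn E M)

lemma K_swap₁ : C.inner (C.dorfman b a) c =
    (C.rho c).deriv (C.inner a b) - C.inner (C.dorfman a b) c := by
  have h := congrArg (fun s => C.inner s c) (C.dorfman_add_symm a b)
  simp only [pair_add_left, inner_D] at h
  linear_combination h

lemma K_swap₂ : C.inner (C.dorfman a c) b =
    (C.rho a).deriv (C.inner b c) - C.inner (C.dorfman a b) c := by
  rw [invariance', C.inner_symm' b]; ring

lemma K_cycle : C.inner (C.dorfman b c) a = C.inner (C.dorfman a b) c
    + (C.rho b).deriv (C.inner a c) - (C.rho c).deriv (C.inner a b) := by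
  rw [K_swap₂, K_swap₁]; ring

lemma K_cycle' : C.inner (C.dorfman c a) b = C.inner (C.dorfman a b) c
    + (C.rho b).deriv (C.inner a c) - (C.rho a).deriv (C.inner b c) := by
  rw [K_swap₁, K_swap₂]; ring

lemma inner_bracket : C.inner (C.bracket a b) c =
    C.inner (C.dorfman a b) c - (1 / 2 : ℝ) • (C.rho c).deriv (C.inner a b) := by
  rw [bracket_eq, sub_eq_add_neg, pair_add_left, pair_neg_left, pair_smul_left, inner_D]
  module

/-- The function `T` of a Courant algebroid. -/
def T : SmoothFn E M := C.toPreCourant.T C.bracket a b c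

lemma T_eq : C.T a b c = (1 / 2 : ℝ) • C.inner (C.dorfman a b) c
    - (1 / 4 : ℝ) • ((C.rho a).deriv (C.inner b c) - (C.rho b).deriv (C.inner a c)
      + (C.rho c).deriv (C.inner a b)) := by
  unfold T PreCourant.T
  simp only [inner_bracket]
  rw [C.K_cycle a b c, C.K_cycle' a b c, C.inner_symm' c a]
  module

lemma bracket_dorfman : C.bracket a (C.bracket b c) = C.dorfman a (C.dorfman b c)
    - (1 / 2 : ℝ) • C.D (C.inner (C.dorfman b c) a)
    - (1 / 4 : ℝ) • C.D ((C.rho a).deriv (C.inner b c)) := by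
  rw [C.bracket_eq b c, map_sub, map_smul, bracket_D, bracket_eq, C.inner_symm' a]
  module

lemma bracket_dorfman' : C.bracket (C.bracket a b) c = C.dorfman (C.dorfman a b) c
    - (1 / 2 : ℝ) • C.D (C.inner (C.dorfman a b) c)
    + (1 / 4 : ℝ) • C.D ((C.rho c).deriv (C.inner a b)) := by
  rw [C.bracket_eq a b, map_sub, map_smul, LinearMap.sub_apply, LinearMap.smul_apply,
    C.bracket_skew (C.D _) c, bracket_D, bracket_eq]
  module

lemma D_sub : C.D (f - g) = C.D f - C.D g := by
  rw [sub_eq_add_neg, D_add, D_neg, ← sub_eq_add_neg]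

lemma dorfman_jacobi : C.dorfman a (C.dorfman b c) =
    C.dorfman (C.dorfman a b) c + C.dorfman b (C.dorfman a c) := by
  have h := C.jacobi a b c
  have hT : C.toPreCourant.T C.bracket a b c = C.T a b c := rfl
  rw [hT, T_eq, bracket_dorfman, bracket_dorfman, bracket_dorfman'] at h
  rw [C.K_cycle a b c, C.K_swap₂ a b c] at h
  simp only [D_sub, D_add, D_smul] at h
  linear_combination (norm := module) h

lemma T_swap₁ : C.T a b c = -C.T b a c := by
  rw [T_eq, T_eq, C.K_swap₁ a b c, C.inner_symm' b a]
  module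

lemma T_swap₂ : C.T a b c = -C.T a c b := by
  rw [T_eq, T_eq, C.K_swap₂ a b c, C.inner_symm' c b]
  module

lemma rho_bracket_deriv : (C.rho (C.bracket a b)).deriv f =
    (C.rho a).deriv ((C.rho b).deriv f) - (C.rho b).deriv ((C.rho a).deriv f) := by
  rw [C.rho_bracket, VF.lie_deriv]

lemma T_D : C.T a b (C.D f) =
    (1 / 4 : ℝ) • ((C.rho a).deriv ((C.rho b).deriv f) - (C.rho b).deriv ((C.rho a).deriv f)) := by
  rw [T_eq, inner_D', inner_D', inner_D', rho_D_deriv, rho_dorfman_deriv]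
  module

lemma K_dorfman : C.inner (C.dorfman (C.dorfman a b) c) e =
    (C.rho e).deriv (C.inner (C.dorfman a b) c) - (C.rho c).deriv (C.inner (C.dorfman a b) e)
      + C.inner (C.dorfman a b) (C.dorfman c e) := by
  rw [C.K_swap₁ c (C.dorfman a b) e, C.invariance' c (C.dorfman a b) e, C.inner_symm' c]
  ring

lemma T_bracket : C.T (C.bracket a b) c e =
    (1 / 4 : ℝ) • ((C.rho e).deriv (C.inner (C.dorfman a b) c)
      - (C.rho c).deriv (C.inner (C.dorfman a b) e))
    + (1 / 2 : ℝ) • C.inner (C.dorfman a b) (C.dorfman c e)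
    - (1 / 4 : ℝ) • ((C.rho a).deriv ((C.rho b).deriv (C.inner c e))
      - (C.rho b).deriv ((C.rho a).deriv (C.inner c e)))
    - (1 / 8 : ℝ) • ((C.rho c).deriv ((C.rho e).deriv (C.inner a b))
      - (C.rho e).deriv ((C.rho c).deriv (C.inner a b))) := by
  have hd : C.inner (C.dorfman (C.bracket a b) c) e = C.inner (C.dorfman (C.dorfman a b) c) e := by
    have : C.dorfman (C.bracket a b) c = C.dorfman (C.dorfman a b) c := by
      have h := C.D_dorfman c (C.inner a b)
      rw [C.bracket_eq a b]
      unfold dorfman at h ⊢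
      simp only [map_smul, LinearMap.smul_apply, sub_eq_add_neg,
        pair_add_left, pair_neg_left, pair_smul_left, D_add, D_neg, D_smul, map_add, map_neg,
        LinearMap.add_apply, LinearMap.neg_apply] at h ⊢
      linear_combination (norm := module) (-1 / 2 : ℝ) • h
    rw [this]
  rw [T_eq, hd, K_dorfman, rho_bracket_deriv, inner_bracket, inner_bracket]
  simp only [VF.deriv_sub, VF.deriv_smul]
  module

lemma J_star :
    (C.rho x).deriv (C.inner (C.dorfman y z) w) - C.inner (C.dorfman y z) (C.dorfman x w) =
      (C.rho w).deriv (C.inner (C.dorfman x y) z) - (C.rho z).deriv (C.inner (C.dorfman x y) w)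
      + C.inner (C.dorfman x y) (C.dorfman z w)
      + (C.rho y).deriv (C.inner (C.dorfman x z) w) - C.inner (C.dorfman x z) (C.dorfman y w) := by
  have h := congrArg (fun s => C.inner s w) (C.dorfman_jacobi x y z)
  simp only [pair_add_left] at h
  rw [K_dorfman] at h
  have h1 := C.invariance' x (C.dorfman y z) w
  have h2 := C.invariance' y (C.dorfman x z) w
  linear_combination h + h1 - h2


lemma act_eq : C.inner e (C.D f) = (C.rho e).deriv f := C.inner_D' f e

set_option maxHeartbeats 1000000 in
lemma T_coherence :
    (1 / 2 : ℝ) • (C.rho x).deriv (C.T y z w) + C.T x (C.bracket y z) w + C.T x z (C.bracket y w)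
      - (1 / 2 : ℝ) • (C.rho w).deriv (C.T x y z) + (1 / 2 : ℝ) • (C.rho z).deriv (C.T x y w) =
    C.T x y (C.bracket z w) + C.T (C.bracket x y) z w + (1 / 2 : ℝ) • (C.rho y).deriv (C.T x z w)
      + C.T y (C.bracket x z) w + C.T y z (C.bracket x w) := by
  have hc (a b c : Sec E F V) : C.T a b c = C.T c a b := by
    rw [C.T_swap₂, C.T_swap₁, neg_neg]
  rw [C.T_swap₁ x (C.bracket y z) w, C.T_swap₁ y (C.bracket x z) w, hc x z (C.bracket y w),
    hc x y (C.bracket z w), hc y z (C.bracket x w)]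
  simp only [T_bracket]
  have h := C.J_star x y z w
  rw [C.inner_symm' (C.dorfman z w) (C.dorfman x y), C.inner_symm' (C.dorfman y w) (C.dorfman x z),
    C.inner_symm' (C.dorfman x w) (C.dorfman y z),
    C.K_cycle x y z, C.K_cycle x z w, C.K_cycle x y w, C.K_cycle y z w,
    C.K_swap₂ x y z, C.K_swap₂ x z w, C.K_swap₂ x y w, C.K_swap₂ y z w]
  simp only [T_eq, VF.deriv_add, VF.deriv_sub, VF.deriv_smul]
  linear_combination (norm := module) h

lemma T_add₁ (a' : Sec E F V) : C.T (a + a') b c = C.T a b c + C.T a' b c := by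
  unfold T PreCourant.T
  simp only [map_add, LinearMap.add_apply, pair_add_left, pair_add_right]
  module

lemma T_smul₁ (r : ℝ) : C.T (r • a) b c = r • C.T a b c := by
  unfold T PreCourant.T
  simp only [map_smul, LinearMap.smul_apply, pair_smul_left, pair_smul_right]
  module

lemma T_add₂ (b' : Sec E F V) : C.T a (b + b') c = C.T a b c + C.T a b' c := by
  rw [T_swap₁, T_add₁, C.T_swap₁ b, C.T_swap₁ b']; ring

lemma T_smul₂ (r : ℝ) : C.T a (r • b) c = r • C.T a b c := by
  rw [T_swap₁, T_smul₁, C.T_swap₁ b]; module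

lemma T_add₃ (c' : Sec E F V) : C.T a b (c + c') = C.T a b c + C.T a b c' := by
  rw [T_swap₂, T_add₂, C.T_swap₂ a c, C.T_swap₂ a c']; ring

lemma T_smul₃ (r : ℝ) : C.T a b (r • c) = r • C.T a b c := by
  rw [T_swap₂, T_smul₂, C.T_swap₂ a c]; module

lemma rho_D : C.rho (C.D f) = 0 := by
  have key (e₁ e₂ : Sec E F V) (x : M) : C.inner e₁ e₂ x • C.rho (C.D f) x = 0 := by
    have h1 : C.rho (C.bracket e₁ (f • e₂)) = ⁅C.rho e₁, f • C.rho e₂⁆ := by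
      rw [C.rho_bracket]; congr 1; ext y; exact map_smul (C.anchor y) _ _
    have h2 : C.rho (C.bracket e₁ e₂) x = (⁅C.rho e₁, C.rho e₂⁆ : VF E M) x := by
      rw [C.rho_bracket]
    rw [VF.lie_fsmul, C.leibniz] at h1
    have h3 := congrArg (fun v : VF E M => v x) h1
    simp only [rho_apply, ContMDiffSection.coe_add, ContMDiffSection.coe_sub, Pi.add_apply,
      Pi.sub_apply, Sec.fsmul_apply, map_add, map_sub, map_smul] at h2 h3 ⊢
    rw [← h2] at h3
    change _ + _ - ((1 / 2 : ℝ) * C.inner e₁ e₂ x) • _ = _ at h3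
    linear_combination (norm := module) (-2 : ℝ) • h3
  ext x
  by_cases hx : C.D f x = 0
  · simp [hx]
  · obtain ⟨v, hv⟩ : ∃ v, C.pairing x (C.D f x) v ≠ 0 := by
      by_contra! h
      exact hx ((C.pairing_nondegenerate x).1 _ h)
    obtain ⟨e₂, rfl⟩ := exists_sec_apply_eq (E := E) (F := F) v
    exact (smul_eq_zero.1 (key (C.D f) e₂ x)).resolve_left hv

/-- The operator `D` as a linear map. -/
def Dₗ : SmoothFn E M →ₗ[ℝ] Sec E F V where
  toFun := C.D
  map_add' := C.D_add
  map_smul' := C.D_smul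

@[simp] lemma Dₗ_apply : C.Dₗ f = C.D f := rfl

/-- The bracket in degree 1 of `L_∞(C)`: `[e, f] = 1/2 ⟨e, D f⟩`. -/
def act : Sec E F V →ₗ[ℝ] SmoothFn E M →ₗ[ℝ] SmoothFn E M :=
  LinearMap.mk₂ ℝ (fun e f => (1 / 2 : ℝ) • C.inner e (C.D f))
    (fun _ _ _ => by rw [pair_add_left, smul_add])
    (fun _ _ _ => by rw [pair_smul_left, smul_comm])
    (fun _ _ _ => by rw [D_add, pair_add_right, smul_add])
    (fun _ _ _ => by rw [D_smul, pair_smul_right, smul_comm])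

@[simp] lemma act_apply : C.act e f = (1 / 2 : ℝ) • C.inner e (C.D f) := rfl

/-- The linear map `-T(a, b, ·)`. -/
def negT : Sec E F V →ₗ[ℝ] SmoothFn E M where
  toFun c := -C.T a b c
  map_add' c c' := by rw [T_add₃, neg_add]
  map_smul' r c := by rw [T_smul₃, RingHom.id_apply, smul_neg]

/-- The Jacobiator `J = -T` of `L_∞(C)`. -/
def jac : Sec E F V →ₗ[ℝ] Sec E F V →ₗ[ℝ] Sec E F V →ₗ[ℝ] SmoothFn E M :=
  LinearMap.mk₂ ℝ (fun a b => C.negT a b)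
    (fun a a' b => LinearMap.ext fun c =>
      show -C.T (a + a') b c = -C.T a b c + -C.T a' b c by rw [T_add₁, neg_add])
    (fun r a b => LinearMap.ext fun c =>
      show -C.T (r • a) b c = r • -C.T a b c by rw [T_smul₁, smul_neg])
    (fun a b b' => LinearMap.ext fun c =>
      show -C.T a (b + b') c = -C.T a b c + -C.T a b' c by rw [T_add₂, neg_add])
    (fun r a b => LinearMap.ext fun c =>
      show -C.T a (r • b) c = r • -C.T a b c by rw [T_smul₂, smul_neg])

@[simp] lemma jac_apply : C.jac a b c = -C.T a b c := rfl

/-- The Lie 2-algebra `L_∞(C)` of a Courant algebroid. -/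
def LInfty : Lie2Algebra where
  L0 := Sec E F V
  L1 := SmoothFn E M
  d := C.Dₗ
  bracket := C.bracket
  act := C.act
  jac := C.jac
  bracket_skew := C.bracket_skew
  d_act e f := by
    rw [act_apply, Dₗ_apply, Dₗ_apply, bracket_D, inner_D', D_smul]
  act_d f g := by
    simp only [act_apply, Dₗ_apply, C.inner_D_D, smul_zero, neg_zero]
  jac_skew₁ x y z := by rw [jac_apply, jac_apply, C.T_swap₁]
  jac_skew₂ x y z := by rw [jac_apply, jac_apply, C.T_swap₂]
  d_jac x y z := by
    rw [jac_apply, Dₗ_apply, D_neg, ← sub_sub]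
    exact C.jacobi x y z
  jac_d x y f := by
    simp only [jac_apply, Dₗ_apply, act_apply, inner_D', T_D, rho_bracket_deriv, VF.deriv_smul]
    module
  coherence x y z w := by
    have h := C.T_coherence x y z w
    simp only [jac_apply, act_apply, inner_D', VF.deriv_neg]
    linear_combination (norm := module) -h

end CourantAlgebroid

/-- An (isotropic) splitting `s : TM → V` of the anchor. Smoothness is tested on smooth vector
fields. -/
structure Splitting (C : CourantAlgebroid E F V) where
  /-- the bundle map -/
  toFun : ∀ x : M, TangentSpace 𝓘(ℝ, E) x →ₗ[ℝ] V x
  smooth : ∀ v : VF E M,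
    ContMDiff 𝓘(ℝ, E) (𝓘(ℝ, E).prod 𝓘(ℝ, F)) ∞ (fun x => TotalSpace.mk' F x (toFun x (v x)))
  anchor_splitting : ∀ (x : M) (v : TangentSpace 𝓘(ℝ, E) x), C.anchor x (toFun x v) = v
  isotropic : ∀ (x : M) (v w : TangentSpace 𝓘(ℝ, E) x), C.pairing x (toFun x v) (toFun x w) = 0

namespace Splitting

variable {C : CourantAlgebroid E F V} (s : Splitting C)

/-- The map `s : 𝔛(M) → Γ(V)` on sections. -/
def map : VF E M →ₗ[ℝ] Sec E F V where
  toFun v := ⟨fun x => s.toFun x (v x), s.smooth v⟩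
  map_add' v w := by ext x; exact map_add (s.toFun x) (v x) (w x)
  map_smul' r v := by ext x; exact map_smul (s.toFun x) r (v x)

/-- The curvature 3-form of the splitting is `Ω`: `⟨[s(v₁), s(v₂)], s(v₃)⟩ = Ω(v₁, v₂, v₃)`. -/
def HasCurvature (Ω : DiffForm E M 3) : Prop :=
  ∀ v₁ v₂ v₃ : VF E M,
    C.inner (C.bracket (s.map v₁) (s.map v₂)) (s.map v₃) = Ω.eval ![v₁, v₂, v₃]

/-- The space `Γ(C)^s` of sections preserving the splitting: those `e` such that
`⟦e, s(v)⟧ = s([ρ(e), v])` for all vector fields `v`. -/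
def preserving : Submodule ℝ (Sec E F V) where
  carrier := {e | ∀ v : VF E M, C.dorfman e (s.map v) = s.map ⁅C.rho e, v⁆}
  zero_mem' v := by
    have h := C.rho_smul 0 0
    rw [zero_smul, zero_smul] at h
    have h' := C.D_dorfman (s.map v) 0
    have h'' := C.D_smul 0 0
    rw [zero_smul, zero_smul] at h''
    rw [h''] at h'
    rw [h', h, zero_lie, map_zero]
  add_mem' {a b} ha hb v := by
    rw [PreCourant.rho_add, add_lie, map_add, ← ha v, ← hb v]
    unfold CourantAlgebroid.dorfman
    rw [map_add, LinearMap.add_apply, PreCourant.pair_add_left, PreCourant.D_add]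
    module
  smul_mem' r a ha v := by
    rw [PreCourant.rho_smul, smul_lie, map_smul, ← ha v]
    unfold CourantAlgebroid.dorfman
    rw [map_smul, LinearMap.smul_apply, PreCourant.pair_smul_left, PreCourant.D_smul]
    module

lemma D_mem_preserving (f : SmoothFn E M) : C.D f ∈ s.preserving := by
  intro v
  rw [C.D_dorfman, C.rho_D, zero_lie, map_zero]

lemma bracket_mem_preserving {a b : Sec E F V} (ha : a ∈ s.preserving) (hb : b ∈ s.preserving) :
    C.bracket a b ∈ s.preserving := by
  rw [C.bracket_eq, sub_eq_add_neg, ← neg_smul]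
  refine add_mem (fun v => ?_) (Submodule.smul_mem _ _ (s.D_mem_preserving _))
  have h1 := C.dorfman_jacobi a b (s.map v)
  rw [hb v, ha v, ha, hb] at h1
  have h2 : C.rho (C.dorfman a b) = ⁅C.rho a, C.rho b⁆ := by
    rw [CourantAlgebroid.dorfman, PreCourant.rho_add, PreCourant.rho_smul, C.rho_D, smul_zero,
      add_zero, C.rho_bracket]
  rw [h2, lie_lie, map_sub, h1, add_sub_cancel_right]

end Splitting

/-- The Lie 2-algebra `L_∞(C)^s` of sections preserving the splitting `s`: the Lie 2-subalgebra of
`L_∞(C)` with `L0 = Γ(C)^s` and `L1 = C^∞(M)`. -/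
def LInftyPreserving (C : CourantAlgebroid E F V) (s : Splitting C) : Lie2Algebra :=
  C.LInfty.sub s.preserving s.D_mem_preserving
    (fun _ hx _ hy => s.bracket_mem_preserving hx hy)

end CourantLie

end TwoPlectic

end

universe uE uM uF uV

/-! Exactness and the splitting identify a section `e` with the pair consisting of its vector field
`ρ(e)` and its 1-form `α = ⟨e, s(·)⟩`. Since the curvature is `-Ω`, a section preserves the
splitting exactly when `dα = -ι_{ρ(e)} Ω` (`HasCurvature.mem_preserving_iff`), so `Γ(C)^s` is the
space of Hamiltonian 1-forms paired with their Hamiltonian vector fields.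

This gives the homology of `L_∞(C)^s`. In degree 1 it is the kernel of `D`, that is, the constants,
because `M` is connected. In degree 0 the anchor maps `Γ(C)^s` onto the Hamiltonian vector fields
(`HasCurvature.exists_mem_preserving`). Its kernel consists of the closed 1-forms, which are exact
because `M` is simply connected, and so it is the image of `D` (`HasCurvature.exists_D_eq`).

The extension is therefore sought with zero differential, as `ℝ → 𝔛_Ham(M)` with a 3-cocycle as
Jacobiator. The cocycle is `-Ω(u, v, w)` evaluated at a base point `p`; it is closed because `Ω` is
closed and invariant under Hamiltonian flows (`DiffForm.IsClosed.hamVF_cocycle`). The morphism is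
the anchor in degree 0 and evaluation at `p` in degree 1. Its homotopy is the skew pairing `1/2 (⟨b,
s(ρ(a))⟩ - ⟨a, s(ρ(b))⟩)` at `p`. What has to be checked is that `-T` and `-Ω` differ by the
coboundary of this pairing on sections preserving the splitting (`HasCurvature.T_add_eval`).

Exactness of closed 1-forms is proved by the Poincaré lemma in charts, followed by gluing: local
primitives differ by locally constant functions, hence define a covering space, which has a section
over a simply connected base. -/

open scoped Topology

/-! ### Gluing local functions up to constants by a covering space -/

/-- The covering space whose sections are the functions differing locally from given local
functions by constants. -/
def primitiveBundleCore {X A : Type*} [TopologicalSpace X] [AddCommGroup A] [TopologicalSpace A]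
    [DiscreteTopology A] (U : X → Set X) (hUo : ∀ x, IsOpen (U x)) (hU : ∀ x, x ∈ U x)
    (f : X → X → A)
    (h : ∀ i j, ∀ y ∈ U i ∩ U j, ∀ᶠ z in 𝓝 y, f i z - f j z = f i y - f j y) :
    FiberBundleCore X X A where
  baseSet := U
  isOpen_baseSet := hUo
  indexAt := id
  mem_baseSet_at := hU
  -- The coordinate `t` of a value `F` in the chart `i` stands for `F - f i`, so passing to the
  -- chart `j` adds `f i - f j`.
  coordChange i j x t := t + (f i x - f j x)
  coordChange_self i x _ t := by simp
  continuousOn_coordChange i j := by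
    refine fun p hp => ContinuousAt.continuousWithinAt ?_
    -- `h` makes the transition cocycle locally constant, hence continuous into the discrete group
    -- `A`.
    have h2 : ContinuousAt (fun p : X × A => f i p.1 - f j p.1) p :=
      continuousAt_const.congr
        ((continuousAt_fst.eventually (h i j p.1 hp.1)).mono fun q hq => hq.symm)
    exact ContinuousAt.comp (f := fun p : X × A => (p.2, f i p.1 - f j p.1))
      (g := fun q : A × A => q.1 + q.2) continuous_of_discreteTopology.continuousAt
      (continuousAt_snd.prodMk h2)
  coordChange_comp i j k x _ t := by abel

/-- On a simply connected space, local functions that differ from each other by locally constant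
functions come, up to constants, from a global function. -/
lemma exists_eventually_sub_eq_of_simplyConnected {X A : Type*} [TopologicalSpace X]
    [SimplyConnectedSpace X] [LocallyPathConnectedSpace X] [AddCommGroup A]
    (U : X → Set X) (hUo : ∀ x, IsOpen (U x)) (hU : ∀ x, x ∈ U x) (f : X → X → A)
    (h : ∀ i j, ∀ y ∈ U i ∩ U j, ∀ᶠ z in 𝓝 y, f i z - f j z = f i y - f j y) :
    ∃ F : X → A, ∀ x, ∀ᶠ y in 𝓝 x, F y - f x y = F x - f x x := by
  -- With a discrete fibre the bundle is a covering, and continuity of a fibre coordinate means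
  -- local constancy.
  let : TopologicalSpace A := ⊥
  have : DiscreteTopology A := ⟨rfl⟩
  let Z := primitiveBundleCore U hUo hU f h
  have hcov : IsCoveringMap Z.proj :=
    IsCoveringMap.mk _ (fun _ => A) (fun x => Z.localTrivAt x) fun x => Z.mem_baseSet_at x
  obtain ⟨x₀⟩ : Nonempty X := inferInstance
  -- Simple connectedness enters here: the identity of `X` lifts to the covering, which gives a
  -- global section.
  obtain ⟨G, ⟨-, hG⟩, -⟩ := hcov.existsUnique_continuousMap_lifts (ContinuousMap.id X) x₀
    (⟨x₀, (0 : A)⟩ : Z.TotalSpace) rfl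
  have hGp (x : X) : (G x).proj = x := congrFun hG x
  let t : X → A := fun x => (G x).snd
  -- The point over `x` is recorded in the chart indexed by `x` itself, so `t x` stands for `F x - f
  -- x x`. In the fixed chart `x` the coordinate of the section at a nearby `y` is `F y - f x y`,
  -- and continuity makes it locally constant.
  refine ⟨fun x => t x + f x x, fun x => ?_⟩
  have hc : ContinuousAt (fun y => (Z.localTrivAt x (G y)).2) x := by
    have h1 : ContinuousAt (Z.localTrivAt x) (G x) :=
      (Z.localTrivAt x).toOpenPartialHomeomorph.continuousAt (by
        change (G x).proj ∈ U x
        rw [hGp]; exact hU x)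
    exact continuousAt_snd.comp (h1.comp G.continuous.continuousAt)
  have hev := hc.eventually (isOpen_discrete {(Z.localTrivAt x (G x)).2}|>.mem_nhds rfl)
  filter_upwards [hev] with y hy
  have key (y : X) : (Z.localTrivAt x (G y)).2 = t y + (f y y - f x y) := by
    rw [Z.localTrivAt_snd]
    change t y + (f (G y).proj (G y).proj - f x (G y).proj) = _
    rw [hGp]
  have hy' : (Z.localTrivAt x (G y)).2 = (Z.localTrivAt x (G x)).2 := hy
  rw [key, key] at hy'
  rw [add_sub_assoc, hy', add_sub_assoc]

/-! ### The Poincaré lemma for 1-forms in a chart -/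

namespace TwoPlectic
section LocalPrimitive

variable {E : Type*} [NormedAddCommGroup E] [NormedSpace ℝ E]
  {M : Type*} [TopologicalSpace M] [ChartedSpace E M] [IsManifold 𝓘(ℝ, E) ∞ M]

/-- A basis transported by `e` is again a basis. With `e` the derivative of a chart, this recovers a
1-form from its values on the coordinate frame. -/
lemma _root_.ContinuousLinearEquiv.sum_apply_symm_mul_coord {T ι : Type*} [AddCommGroup T]
    [Module ℝ T] [TopologicalSpace T] [Fintype ι] (e : T ≃L[ℝ] E) (b : Module.Basis ι ℝ E)
    (A : T →ₗ[ℝ] ℝ) (v : T) : ∑ i, A (e.symm (b i)) * b.coord i (e v) = A v := by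
  have h := congrArg (A.comp e.symm.toLinearMap) (b.sum_repr (e v))
  rw [map_sum] at h
  simpa [mul_comm] using h

lemma mvfderiv_congr {f g : M → ℝ} {x : M} (h : f =ᶠ[𝓝 x] g) :
    mvfderiv 𝓘(ℝ, E) f x = mvfderiv 𝓘(ℝ, E) g x := by
  unfold mvfderiv
  rw [h.mfderiv_eq]
  rfl

lemma mvfderiv_comp_extChartAt {p : E → ℝ} {L : E →L[ℝ] ℝ} {x y : M}
    (hy : y ∈ (extChartAt 𝓘(ℝ, E) x).source)
    (hp : HasFDerivAt p L (extChartAt 𝓘(ℝ, E) x y)) (v : TangentSpace 𝓘(ℝ, E) y) :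
    mvfderiv 𝓘(ℝ, E) (fun z : M => p (extChartAt 𝓘(ℝ, E) x z)) y v =
      L (mfderiv 𝓘(ℝ, E) 𝓘(ℝ, E) (extChartAt 𝓘(ℝ, E) x) y v) := by
  have h1 : MDifferentiableAt 𝓘(ℝ, E) 𝓘(ℝ, E) (extChartAt 𝓘(ℝ, E) x) y :=
    (contMDiffAt_extChartAt' (n := ∞) (by simpa using hy)).mdifferentiableAt (by simp)
  have h2 := (hp.hasMFDerivAt.comp y h1.hasMFDerivAt).mfderiv
  have h3 : mfderiv 𝓘(ℝ, E) 𝓘(ℝ, ℝ) (fun z : M => p (extChartAt 𝓘(ℝ, E) x z)) y =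
    L.comp (mfderiv 𝓘(ℝ, E) 𝓘(ℝ, E) (extChartAt 𝓘(ℝ, E) x) y) := h2
  simp only [mvfderiv, h3]
  rfl

variable [FiniteDimensional ℝ E] [T2Space M]

/-- Constant vector fields in a chart extend, after shrinking, to global vector fields. -/
lemma exists_VF_eventuallyEq_mpullback_const (x : M) (a : E) :
    ∃ X : VF E M, ∀ᶠ y in 𝓝 x,
      X y = mpullback 𝓘(ℝ, E) 𝓘(ℝ, E) (extChartAt 𝓘(ℝ, E) x) (fun _ => a) y := by
  have := FiniteDimensional.complete ℝ E
  refine exists_sec_eventuallyEq (E := E) (F := E) (V := fun x : M => TangentSpace 𝓘(ℝ, E) x)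
    (isOpen_extChartAt_source (I := 𝓘(ℝ, E)) x) (mem_extChartAt_source x) _ ?_
  intro y hy
  refine ContMDiffAt.contMDiffWithinAt ?_
  refine ContMDiffAt.mpullback_vectorField_preimage (n := ∞) ?_
    (contMDiffAt_extChartAt' (by simpa using hy)) (isInvertible_mfderiv_extChartAt hy) (by simp)
  exact (contMDiff_vectorSpace_iff_contDiff (V := fun _ : E => a)|>.2 contDiff_const).contMDiffAt

/-- Pullback along a chart commutes with the Lie bracket, and constant fields on `E` commute.
Coordinate fields therefore contribute no bracket term to `dα`. -/
lemma mlieBracket_mpullback_const {x y : M} (hy : y ∈ (extChartAt 𝓘(ℝ, E) x).source) (a b : E) :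
    mlieBracket 𝓘(ℝ, E) (mpullback 𝓘(ℝ, E) 𝓘(ℝ, E) (extChartAt 𝓘(ℝ, E) x) (fun _ => a))
      (mpullback 𝓘(ℝ, E) 𝓘(ℝ, E) (extChartAt 𝓘(ℝ, E) x) (fun _ => b)) y = 0 := by
  have := FiniteDimensional.complete ℝ E
  have : IsManifold 𝓘(ℝ, E) (minSmoothness ℝ 2) M := by
    simp only [minSmoothness_of_isRCLikeNormedField]; infer_instance
  have : IsManifold 𝓘(ℝ, E) (minSmoothness ℝ 3) M := by
    simp only [minSmoothness_of_isRCLikeNormedField]; infer_instance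
  have hc (a : E) : MDifferentiableAt 𝓘(ℝ, E) 𝓘(ℝ, E).tangent
      (fun z : E => (⟨z, a⟩ : TangentBundle 𝓘(ℝ, E) E)) (extChartAt 𝓘(ℝ, E) x y) :=
    ((contMDiff_vectorSpace_iff_contDiff (n := 1) (V := fun _ : E => a)).2
      contDiff_const).contMDiffAt.mdifferentiableAt (by simp)
  rw [← mpullback_mlieBracket (n := ∞) (hc a) (hc b)
    (contMDiffAt_extChartAt' (by simpa using hy))
    (by simp [minSmoothness_of_isRCLikeNormedField]; exact ENat.LEInfty.out)]
  have h1 (a b : ∀ z : E, TangentSpace 𝓘(ℝ, E) z) :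
      mlieBracket 𝓘(ℝ, E) a b = lieBracketWithin ℝ a b Set.univ := by
    rw [← mlieBracketWithin_univ, mlieBracketWithin_eq_lieBracketWithin]
  have h0 : mlieBracket 𝓘(ℝ, E) (fun _ : E => a) (fun _ => b) = fun _ => (0 : E) := by
    refine (h1 _ _).trans ?_
    ext z
    simp [lieBracketWithin]
  rw [mpullback_apply, h0]
  exact map_zero _

/-- The Poincaré lemma for 1-forms on a manifold. -/
lemma DiffForm.IsClosed.exists_local_primitive {α : DiffForm E M 1} (hα : α.IsClosed) (x : M) :
    ∃ U : Set M, IsOpen U ∧ x ∈ U ∧ ∃ h : M → ℝ, ContMDiffOn 𝓘(ℝ, E) 𝓘(ℝ, ℝ) ∞ h U ∧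
      ∀ y ∈ U, ∀ v, mvfderiv 𝓘(ℝ, E) h y v = α.toFun y (fun _ => v) := by
  have := FiniteDimensional.complete ℝ E
  set φ := extChartAt 𝓘(ℝ, E) x with hφ
  let b := Module.finBasis ℝ E
  choose X hX using fun i => exists_VF_eventuallyEq_mpullback_const (M := M) x (b i)
  obtain ⟨N, hN, hNo, hxN⟩ := mem_nhds_iff.1 (Filter.eventually_all.2 hX)
  let g := fun i => α.eval ![X i]
  have hXN {y : M} (hy : y ∈ N) (i) :
      X i y = (mfderiv 𝓘(ℝ, E) 𝓘(ℝ, E) φ y).inverse (b i) := hN hy i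
  have hcont : ContinuousAt φ.symm (φ x) := continuousAt_extChartAt_symm x
  have hball : φ.target ∩ φ.symm ⁻¹' N ∈ 𝓝 (φ x) :=
    Filter.inter_mem (extChartAt_target_mem_nhds x) (hcont.preimage_mem_nhds (by
      rw [extChartAt_to_inv x]; exact hNo.mem_nhds hxN))
  obtain ⟨r, hr, hB⟩ := Metric.mem_nhds_iff.1 hball
  set B := Metric.ball (φ x) r
  let c := fun i => LinearMap.toContinuousLinearMap (b.coord i)
  -- `η` is `α` read in the chart: its components in the dual basis are the values of `α` on the
  -- coordinate fields `X i`.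
  let η : E → E →L[ℝ] ℝ := fun z => ∑ i, g i (φ.symm z) • c i
  have hg (i) : ContDiffOn ℝ ∞ (fun z => g i (φ.symm z)) B := by
    rw [← contMDiffOn_iff_contDiffOn]
    exact (g i).contMDiff.comp_contMDiffOn
      ((contMDiffOn_extChartAt_symm x).mono fun z hz => (hB hz).1)
  have hη : ContDiffOn ℝ ∞ η B := ContDiffOn.sum fun i _ => (hg i).smul contDiffOn_const
  have hηα {y : M} (hys : y ∈ φ.source) (hy : y ∈ N) (v : TangentSpace 𝓘(ℝ, E) y) :
      η (φ y) (mfderiv 𝓘(ℝ, E) 𝓘(ℝ, E) φ y v) = α.toFun y (fun _ => v) := by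
    obtain ⟨e, he⟩ := isInvertible_mfderiv_extChartAt (I := 𝓘(ℝ, E)) hys
    let A : TangentSpace 𝓘(ℝ, E) y →ₗ[ℝ] ℝ :=
      (AlternatingMap.ofSubsingleton ℝ (TangentSpace 𝓘(ℝ, E) y) ℝ (0 : Fin 1)).symm (α.toFun y)
    have hA (w) : α.toFun y (fun _ => w) = A w := rfl
    have hgA (i) : g i y = A (e.symm (b i)) := by
      have h : X i y = e.symm (b i) := by
        rw [hXN hy, ← he, ContinuousLinearMap.inverse_equiv]
        rfl
      rw [← h, ← hA]
      simp only [g, DiffForm.eval_apply]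
      congr 1; ext j; simp
    rw [hA, ← ContinuousLinearEquiv.sum_apply_symm_mul_coord (E := E) e b A v, ← he]
    simp only [η, φ.left_inv hys, hgA]
    exact sum_apply _ _ _
  have hBy {z : E} (hz : z ∈ B) : φ.symm z ∈ φ.source ∧ φ.symm z ∈ N ∧ φ (φ.symm z) = z :=
    ⟨φ.map_target (hB hz).1, (hB hz).2, φ.right_inv (hB hz).1⟩
  -- The partial derivatives of the components of `η` are the functions `X i (α (X j))` on the
  -- manifold, which is the form in which closedness of `α` is available.
  have hderiv {z : E} (hz : z ∈ B) (i j) : fderiv ℝ η z (b i) (b j) =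
      (X i).deriv (g j) (φ.symm z) := by
    obtain ⟨hs, hn, he⟩ := hBy hz
    have hz' := Metric.isOpen_ball.mem_nhds hz
    have h1 : DifferentiableAt ℝ η z := (hη.differentiableOn (by simp)).differentiableAt hz'
    have h2 : DifferentiableAt ℝ (fun z => g j (φ.symm z)) z :=
      ((hg j).differentiableOn (by simp)).differentiableAt hz'
    have h3 : (fun z => η z (b j)) = fun z => g j (φ.symm z) := by
      ext z
      simp [η, c, Finsupp.single_apply]
    have h4 : fderiv ℝ η z (b i) (b j) = fderiv ℝ (fun z => η z (b j)) z (b i) := by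
      rw [fderiv_clm_apply h1 (differentiableAt_const _)]
      simp
    rw [h4, h3, VF.deriv_apply, hXN hn]
    have h5 : dAt (g j) (φ.symm z) =
        mvfderiv 𝓘(ℝ, E) (fun y : M => (fun z => g j (φ.symm z)) (φ y)) (φ.symm z) := by
      refine mvfderiv_congr ?_
      filter_upwards [(isOpen_extChartAt_source (I := 𝓘(ℝ, E)) x).mem_nhds hs] with y hy
      simp only [hφ, (extChartAt 𝓘(ℝ, E) x).left_inv hy]
    have h6 : HasFDerivAt (fun z => g j (φ.symm z)) (fderiv ℝ (fun z => g j (φ.symm z)) z)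
        (φ (φ.symm z)) := by rw [he]; exact h2.hasFDerivAt
    rw [h5, mvfderiv_comp_extChartAt hs h6]
    obtain ⟨e, he⟩ := isInvertible_mfderiv_extChartAt (I := 𝓘(ℝ, E)) hs
    rw [← hφ] at he
    rw [← he, ContinuousLinearMap.inverse_equiv]
    exact congrArg _ (e.apply_symm_apply (b i)).symm
  -- Since `[X i, X j]` vanishes near the point, `dα(X i, X j) = 0` is the symmetry of the
  -- derivative of `η` on basis vectors; bilinearity does the rest.
  have hsymm : ∀ z ∈ B, ∀ v w, fderiv ℝ η z v w = fderiv ℝ η z w v := by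
    intro z hz
    obtain ⟨hs, hn, he⟩ := hBy hz
    have key (i j) : fderiv ℝ η z (b i) (b j) = fderiv ℝ η z (b j) (b i) := by
      rw [hderiv hz, hderiv hz]
      have h1 := hα ![X i, X j]
      rw [DiffForm.d_one] at h1
      have h2 := congrArg (fun f : SmoothFn E M => f (φ.symm z)) h1
      have hloc (i) : ∀ᶠ y in 𝓝 (φ.symm z), X i y =
          mpullback 𝓘(ℝ, E) 𝓘(ℝ, E) (extChartAt 𝓘(ℝ, E) x) (fun _ => b i) y := by
        filter_upwards [hNo.mem_nhds hn] with y hy using hXN hy i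
      have h3 : (⁅X i, X j⁆ : VF E M) (φ.symm z) = 0 := by
        rw [VF.bracket_apply]
        exact (Filter.EventuallyEq.mlieBracket_vectorField_eq (hloc i) (hloc j)).trans
          (mlieBracket_mpullback_const hs _ _)
      have h4 : α.eval ![⁅X i, X j⁆] (φ.symm z) = 0 := by
        rw [DiffForm.eval_apply]
        exact AlternatingMap.map_coord_zero _ (0 : Fin 1) (by simpa using h3)
      have h5 : (X i).deriv (g j) (φ.symm z) - (X j).deriv (g i) (φ.symm z)
        - α.eval ![⁅X i, X j⁆] (φ.symm z) = 0 := h2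
      linarith
    have hl : (ContinuousLinearMap.toLinearMap₁₂ (fderiv ℝ η z)) =
        (ContinuousLinearMap.toLinearMap₁₂ (fderiv ℝ η z)).flip :=
      b.ext fun i => b.ext fun j => key i j
    intro v w
    exact LinearMap.congr_fun₂ hl v w
  obtain ⟨p, hp⟩ := (convex_ball (φ x) r).exists_forall_hasFDerivAt_of_fderiv_symmetric
    Metric.isOpen_ball (hη.differentiableOn (by simp)) hsymm
  -- The primitive is only known to be differentiable so far; its derivative `η` is smooth, and
  -- hence so is `p`.
  have hps : ContDiffOn ℝ ∞ p B := by
    rw [contDiffOn_infty_iff_fderiv_of_isOpen Metric.isOpen_ball]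
    exact ⟨fun z hz => (hp z hz).differentiableAt.differentiableWithinAt,
      hη.congr fun z hz => (hp z hz).fderiv⟩
  refine ⟨φ.source ∩ φ ⁻¹' B, ?_,
    ⟨mem_extChartAt_source x, Metric.mem_ball_self hr⟩, fun y => p (φ y), ?_, ?_⟩
  · exact (continuousOn_extChartAt x).isOpen_inter_preimage (isOpen_extChartAt_source x)
      Metric.isOpen_ball
  · exact (contMDiffOn_iff_contDiffOn.2 hps).comp
      ((contMDiffOn_extChartAt (n := ∞)).mono fun y hy => by simpa [hφ] using hy.1)
      fun y hy => hy.2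
  · rintro y ⟨hy, hyB⟩ v
    rw [mvfderiv_comp_extChartAt hy (hp _ hyB)]
    have := (hBy hyB).2.1
    rw [φ.left_inv hy] at this
    exact hηα hy this v

end LocalPrimitive
end TwoPlectic

/-! ### Global primitives of closed 1-forms -/

namespace TwoPlectic
section Primitive

variable {E : Type*} [NormedAddCommGroup E] [NormedSpace ℝ E]
  {M : Type*} [TopologicalSpace M] [ChartedSpace E M] [IsManifold 𝓘(ℝ, E) ∞ M]

/-- Read in a chart, the function has zero derivative on a ball, which is convex. The hypotheses are
only local so that the lemma also applies to differences of local primitives. -/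
lemma eventually_eq_of_mvfderiv_eq_zero {h : M → ℝ} {x : M}
    (hd : ∀ᶠ y in 𝓝 x, MDifferentiableAt 𝓘(ℝ, E) 𝓘(ℝ, ℝ) h y)
    (h0 : ∀ᶠ y in 𝓝 x, mvfderiv 𝓘(ℝ, E) h y = 0) : ∀ᶠ y in 𝓝 x, h y = h x := by
  set φ := extChartAt 𝓘(ℝ, E) x with hφ
  have hcont : ContinuousAt φ.symm (φ x) := continuousAt_extChartAt_symm x
  have hev := hcont.eventually (by rw [extChartAt_to_inv x]; exact hd.and h0)
  obtain ⟨r, hr, hB⟩ := Metric.mem_nhds_iff.1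
    (Filter.inter_mem (extChartAt_target_mem_nhds (I := 𝓘(ℝ, E)) x) hev)
  have key : ∀ z ∈ Metric.ball (φ x) r, HasFDerivAt (h ∘ φ.symm) (0 : E →L[ℝ] ℝ) z := by
    intro z hz
    obtain ⟨ht, hd', h0'⟩ := hB hz
    have h1 : MDifferentiableAt 𝓘(ℝ, E) 𝓘(ℝ, E) φ.symm z :=
      ((contMDiffOn_extChartAt_symm (n := ∞) x).contMDiffAt
        (extChartAt_target_mem_nhds' ht)).mdifferentiableAt (by simp)
    have h2 := hd'.hasMFDerivAt.comp z h1.hasMFDerivAt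
    have h3 : mfderiv 𝓘(ℝ, E) 𝓘(ℝ, ℝ) h (φ.symm z) = 0 := h0'
    refine h2.hasFDerivAt.congr_fderiv (ContinuousLinearMap.ext fun w => ?_)
    exact congrArg (fun l => l (mfderiv 𝓘(ℝ, E) 𝓘(ℝ, E) φ.symm z w)) h3
  have hconst : ∀ z ∈ Metric.ball (φ x) r, h (φ.symm z) = h x := by
    intro z hz
    have := (convex_ball (φ x) r).is_const_of_fderivWithin_eq_zero (𝕜 := ℝ) (f := h ∘ φ.symm)
      (fun z hz => (key z hz).differentiableAt.differentiableWithinAt)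
      (fun z hz => by
        rw [fderivWithin_of_isOpen Metric.isOpen_ball hz, (key z hz).fderiv])
      hz (Metric.mem_ball_self hr)
    simpa [hφ] using this
  filter_upwards [(isOpen_extChartAt_source (I := 𝓘(ℝ, E)) x).mem_nhds (mem_extChartAt_source x),
    (continuousAt_extChartAt (I := 𝓘(ℝ, E)) x).preimage_mem_nhds (Metric.ball_mem_nhds _ hr)]
    with y hy hy'
  have := hconst _ hy'
  rwa [hφ, (extChartAt 𝓘(ℝ, E) x).left_inv hy] at this

/-- A function with vanishing differential on a connected manifold is constant. -/
lemma eq_of_dAt_eq_zero [PreconnectedSpace M] {f : SmoothFn E M} (hf : ∀ x, dAt f x = 0)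
    (x y : M) : f x = f y :=
  (IsLocallyConstant.iff_eventually_eq f |>.2 fun _ =>
    eventually_eq_of_mvfderiv_eq_zero (.of_forall f.mdiff)
      (.of_forall hf)).apply_eq_of_preconnectedSpace x y

variable [FiniteDimensional ℝ E] [T2Space M]

/-- Closed 1-forms on a simply connected manifold are exact. -/
lemma DiffForm.IsClosed.exists_primitive [SimplyConnectedSpace M] {α : DiffForm E M 1}
    (hα : α.IsClosed) :
    ∃ f : SmoothFn E M, ∀ x v, dAt f x v = α.toFun x (fun _ => v) := by
  have : LocallyPathConnectedSpace M := ChartedSpace.locallyPathConnectedSpace E M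
  choose U hUo hU f hf hfd using hα.exists_local_primitive
  have hmd {i y} (hy : y ∈ U i) : MDifferentiableAt 𝓘(ℝ, E) 𝓘(ℝ, ℝ) (f i) y :=
    ((hf i).contMDiffAt ((hUo i).mem_nhds hy)).mdifferentiableAt (by simp)
  -- On an overlap two local primitives have the same differential `α`, so their difference is
  -- locally constant.
  obtain ⟨F, hF⟩ := exists_eventually_sub_eq_of_simplyConnected U hUo hU f (by
    rintro i j y ⟨hi, hj⟩
    refine eventually_eq_of_mvfderiv_eq_zero (E := E) (h := f i - f j) ?_ ?_
    · filter_upwards [(hUo i).mem_nhds hi, (hUo j).mem_nhds hj] with z hi hj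
      exact (hmd hi).sub (hmd hj)
    · filter_upwards [(hUo i).mem_nhds hi, (hUo j).mem_nhds hj] with z hi hj
      rw [mvfderiv_sub (hmd hi) (hmd hj)]
      ext v
      simp [hfd i z hi, hfd j z hj])
  -- Near `x` the glued function is the local primitive plus a constant, so it inherits both
  -- smoothness and the differential.
  have hFe (x : M) : F =ᶠ[𝓝 x] (f x + fun _ => F x - f x x) := by
    filter_upwards [hF x] with y hy
    rw [Pi.add_apply, ← hy]; abel
  refine ⟨⟨F, fun x => ?_⟩, fun x v => ?_⟩
  · exact (((hf x).contMDiffAt ((hUo x).mem_nhds (hU x))).add contMDiffAt_const).congr_of_eventuallyEq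
      (hFe x)
  · change mvfderiv 𝓘(ℝ, E) F x v = _
    rw [mvfderiv_congr (hFe x), mvfderiv_add (hmd (hU x)) mdifferentiableAt_const, mvfderiv_const,
      add_zero, hfd x x (hU x)]

end Primitive
end TwoPlectic

noncomputable section

namespace TwoPlectic

/-! ### Closed 3-forms and their Hamiltonian vector fields -/

section OneForms

variable {E : Type*} [NormedAddCommGroup E] [NormedSpace ℝ E]
  {M : Type*} [TopologicalSpace M] [ChartedSpace E M] [IsManifold 𝓘(ℝ, E) ∞ M]

/-- The linear form underlying a 1-form. -/
def DiffForm.toDual (α : DiffForm E M 1) (x : M) : Module.Dual ℝ (TangentSpace 𝓘(ℝ, E) x) :=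
  (AlternatingMap.ofSubsingleton ℝ (TangentSpace 𝓘(ℝ, E) x) ℝ (0 : Fin 1)).symm (α.toFun x)

lemma DiffForm.toDual_apply (α : DiffForm E M 1) (x : M) (v : TangentSpace 𝓘(ℝ, E) x) :
    α.toDual x v = α.toFun x (fun _ => v) := rfl

lemma DiffForm.eval_one_apply (α : DiffForm E M 1) (v : VF E M) (x : M) :
    α.eval ![v] x = α.toDual x (v x) := by
  rw [DiffForm.toDual_apply, DiffForm.eval_apply]
  congr 1; ext j; simp

variable [FiniteDimensional ℝ E]

/-- Here `dα = -ι_0 Ω = 0`. Applied to a section in the kernel of the anchor, this lets simple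
connectedness produce a primitive. -/
lemma IsHamiltonianPair.isClosed {Ω : DiffForm E M 3} {α : DiffForm E M 1}
    (h : IsHamiltonianPair Ω α 0) : α.IsClosed := fun u => by
  rw [h u, DiffForm.interior_eval]
  have h0 := Ω.eval_smul₀ 0 (0 : VF E M) u
  rw [zero_smul, zero_smul] at h0
  rw [h0, neg_zero]

variable [T2Space M]

/-- This is `L_x Ω = 0`: by Cartan's formula `L_x Ω = ι_x dΩ + d ι_x Ω`, where `Ω` is closed and
`ι_x Ω = -dα` is exact. -/
lemma IsHamiltonianPair.deriv_eval {Ω : DiffForm E M 3} (hΩ : Ω.IsClosed) {α : DiffForm E M 1}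
    {x : VF E M} (h : IsHamiltonianPair Ω α x) (y z w : VF E M) :
    x.deriv (Ω.eval ![y, z, w]) =
      Ω.eval ![⁅x, y⁆, z, w] - Ω.eval ![⁅x, z⁆, y, w] + Ω.eval ![⁅x, w⁆, y, z] := by
  have h0 := hΩ ![x, y, z, w]
  rw [DiffForm.d_three] at h0
  have h1 := h.closed y z w
  rw [Ω.eval_swap₀₁ x ⁅y, z⁆, Ω.eval_swap₀₁ x ⁅y, w⁆, Ω.eval_swap₀₁ x ⁅z, w⁆] at h1
  linear_combination h0 + h1

lemma DiffForm.eval_lie_skew (Ω : DiffForm E M 3) (x y z w : VF E M) :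
    Ω.eval ![⁅x, y⁆, z, w] = -Ω.eval ![⁅y, x⁆, z, w] := by
  rw [← lie_skew, ← neg_one_smul ℝ, DiffForm.eval_smul₀, neg_one_smul]

/-- A closed 3-form is a Lie algebra cocycle on its Hamiltonian vector fields. -/
lemma DiffForm.IsClosed.hamVF_cocycle {Ω : DiffForm E M 3} (hΩ : Ω.IsClosed)
    {α β γ δ : DiffForm E M 1} {x y z w : VF E M} (hx : IsHamiltonianPair Ω α x)
    (hy : IsHamiltonianPair Ω β y) (hz : IsHamiltonianPair Ω γ z) (hw : IsHamiltonianPair Ω δ w) :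
    Ω.eval ![x, ⁅y, z⁆, w] + Ω.eval ![x, z, ⁅y, w⁆] =
      Ω.eval ![x, y, ⁅z, w⁆] + Ω.eval ![⁅x, y⁆, z, w] + Ω.eval ![y, ⁅x, z⁆, w]
        + Ω.eval ![y, z, ⁅x, w⁆] := by
  have h0 := hΩ ![x, y, z, w]
  -- Invariance turns the four derivative terms of `dΩ` into bracket terms, in which each of the six
  -- brackets occurs twice. The explicit bracket terms of `dΩ` cancel one copy, and what remains is
  -- the cocycle identity.
  rw [DiffForm.d_three, hx.deriv_eval hΩ, hy.deriv_eval hΩ, hz.deriv_eval hΩ,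
    hw.deriv_eval hΩ, Ω.eval_lie_skew y x, Ω.eval_lie_skew z x, Ω.eval_lie_skew w x,
    Ω.eval_lie_skew z y, Ω.eval_lie_skew w y, Ω.eval_lie_skew w z] at h0
  rw [Ω.eval_swap₀₁ x ⁅y, z⁆, Ω.eval_swap₀₁ y ⁅x, z⁆, Ω.eval_swap₁₂ x z, Ω.eval_swap₁₂ x y,
    Ω.eval_swap₁₂ y z, Ω.eval_swap₀₁ x ⁅y, w⁆, Ω.eval_swap₀₁ x ⁅z, w⁆, Ω.eval_swap₀₁ y ⁅x, w⁆]
  linear_combination -h0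

end OneForms

/-! ### The skeletal Lie 2-algebra of a 3-cocycle -/

section Cocycle

universe u

variable (𝔤 : Type u) [LieRing 𝔤] [LieAlgebra ℝ 𝔤] (c : 𝔤 →ₗ[ℝ] 𝔤 →ₗ[ℝ] 𝔤 →ₗ[ℝ] ℝ)
  (h₁ : ∀ x y z, c x y z = -c y x z) (h₂ : ∀ x y z, c x y z = -c x z y)
  (hc : ∀ x y z w, c x ⁅y, z⁆ w + c x z ⁅y, w⁆ =
    c x y ⁅z, w⁆ + c ⁅x, y⁆ z w + c y ⁅x, z⁆ w + c y z ⁅x, w⁆)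

/-- The skeletal Lie 2-algebra `ℝ → 𝔤` of a real-valued 3-cocycle on a Lie algebra `𝔤`. -/
def Lie2Algebra.ofCocycle : Lie2Algebra.{u, 0} where
  L0 := 𝔤
  L1 := ℝ
  d := 0
  bracket := (LieModule.toEnd ℝ 𝔤 𝔤 : 𝔤 →ₗ[ℝ] Module.End ℝ 𝔤)
  act := 0
  jac := c
  bracket_skew x y := by simp
  d_act _ _ := by simp
  act_d _ _ := by simp
  jac_skew₁ := h₁
  jac_skew₂ := h₂
  d_jac x y z := by simp
  jac_d _ _ _ := by simp
  coherence x y z w := by simpa using hc x y z w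

/-- The inclusion of `ℝ` and the projection to `𝔤` are strict, that is, have zero homotopy: the
cocycle vanishes on the zero degree-0 part of `b𝔲(1)`, and the quotient has no degree-1 chains in
which it could be seen. Centrality holds because `𝔤` acts trivially on `ℝ`. -/
lemma Lie2Algebra.isCentralExtension_ofCocycle :
    IsCentralExtension bu1 (Lie2Algebra.ofCocycle 𝔤 c h₁ h₂ hc) (Lie2Algebra.trivial 𝔤) := by
  have hb (x y : 𝔤) : ⁅x, y⁆ - ⁅x, y⁆ = 0 := sub_self _
  have h0 (x : 𝔤) : ⁅(0 : 𝔤), x⁆ = 0 := zero_lie x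
  refine ⟨{ φ0 := 0, φ1 := (LinearMap.id : ℝ →ₗ[ℝ] ℝ), Φ := 0, comm := fun _ => rfl,
            skew := fun _ _ => neg_zero.symm, d_htpy := fun _ _ => ?_, htpy_d := fun _ _ => ?_,
            coherence := fun _ _ _ => ?_ },
    { φ0 := (LinearMap.id : 𝔤 →ₗ[ℝ] 𝔤), φ1 := 0, Φ := 0, comm := fun _ => rfl,
      skew := fun _ _ => rfl, d_htpy := hb,
      htpy_d := fun _ _ => rfl,
      coherence := fun _ _ _ => rfl },
    ⟨fun _ _ _ => rfl, fun x => ⟨fun h => ⟨PUnit.unit, h.symm⟩, ?_⟩, Function.surjective_id⟩,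
    ⟨Function.injective_id, fun r => ⟨fun _ => ⟨r, rfl⟩, fun _ => rfl⟩, fun _ => ⟨(0 : ℝ), rfl⟩⟩,
    fun _ x => h0 x, fun _ _ => rfl, fun _ _ => rfl⟩
  · change (0 : 𝔤) - ⁅(0 : 𝔤), (0 : 𝔤)⁆ = 0
    simp
  · change (0 : ℝ) - 0 = 0
    simp
  · change (0 : ℝ) - c 0 0 0 = 0 - 0 - 0 - -0 + 0 - 0
    simp
  · rintro ⟨_, rfl⟩
    rfl

end Cocycle

/-! ### Sections preserving the splitting as Hamiltonian pairs -/

section Splitting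

variable {E : Type*} [NormedAddCommGroup E] [NormedSpace ℝ E] [FiniteDimensional ℝ E]
  {M : Type*} [TopologicalSpace M] [T2Space M] [ChartedSpace E M] [IsManifold 𝓘(ℝ, E) ∞ M]
  {F : Type*} [NormedAddCommGroup F] [NormedSpace ℝ F] [FiniteDimensional ℝ F]
  {V : M → Type*} [TopologicalSpace (TotalSpace F V)]
  [∀ x, TopologicalSpace (V x)] [FiberBundle F V]
  [∀ x, AddCommGroup (V x)] [∀ x, Module ℝ (V x)] [VectorBundle ℝ F V]
  [ContMDiffVectorBundle ∞ F V 𝓘(ℝ, E)]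

/-- The section `ρ^* α` for a 1-form `α`. -/
def PreCourant.coanchorSec (C : PreCourant E F V) (α : DiffForm E M 1) : Sec E F V where
  toFun x := C.coanchor x (α.toDual x)
  contMDiff_toFun := by
    refine C.contMDiff_of_pairing _ fun e => ?_
    simp only [PreCourant.pairing_coanchor]
    exact α.smooth' fun _ => C.rho e

lemma PreCourant.inner_coanchorSec (C : PreCourant E F V) (α : DiffForm E M 1) (e : Sec E F V) :
    C.inner (C.coanchorSec α) e = α.eval ![C.rho e] := by
  ext x
  rw [DiffForm.eval_one_apply]
  exact C.pairing_coanchor x _ _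

lemma PreCourant.rho_coanchorSec (C : PreCourant E F V) (hC : C.IsExact) (α : DiffForm E M 1) :
    C.rho (C.coanchorSec α) = 0 := by
  ext x
  exact ((hC x).2.1 _).2 ⟨_, rfl⟩

namespace Splitting

open PreCourant

variable {C : CourantAlgebroid E F V} (s : Splitting C)

@[simp] lemma rho_map (v : VF E M) : C.rho (s.map v) = v := by
  ext x
  exact s.anchor_splitting x (v x)

@[simp] lemma inner_map_map (v w : VF E M) : C.inner (s.map v) (s.map w) = 0 := by
  ext x
  exact s.isotropic x (v x) (w x)

/-- The 1-form `⟨e, s(·)⟩`. -/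
def oneForm (e : Sec E F V) : DiffForm E M 1 where
  toFun x := AlternatingMap.ofSubsingleton ℝ (TangentSpace 𝓘(ℝ, E) x) ℝ (0 : Fin 1)
    (C.pairing x (e x) ∘ₗ s.toFun x)
  smooth' v := (C.inner e (s.map (v 0))).contMDiff

lemma oneForm_eval (e : Sec E F V) (v : VF E M) :
    (s.oneForm e).eval ![v] = C.inner e (s.map v) := rfl

/-- Sections decompose as `e = s(ρ(e)) + ρ^* α`. -/
lemma inner_eq (hC : C.IsExact) (a b : Sec E F V) :
    C.inner a b = C.inner a (s.map (C.rho b)) + C.inner b (s.map (C.rho a)) := by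
  ext x
  obtain ⟨ξ, hξ⟩ := ((hC x).2.1 (a x - s.toFun x (C.anchor x (a x)))).1 (by
    rw [map_sub, s.anchor_splitting, sub_self])
  -- The first difference is of the form `ρ^* ξ` by exactness, and `ρ^* ξ` is orthogonal to the
  -- kernel of the anchor, which contains the second difference.
  have h0 : C.pairing x (a x - s.toFun x (C.anchor x (a x)))
      (b x - s.toFun x (C.anchor x (b x))) = 0 := by
    rw [← hξ, C.pairing_coanchor, map_sub, s.anchor_splitting, sub_self, map_zero]
  have h1 := s.isotropic x (C.anchor x (a x)) (C.anchor x (b x))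
  have h2 := C.pairing_symm x (b x) (s.toFun x (C.anchor x (a x)))
  simp only [map_sub, LinearMap.sub_apply] at h0
  change C.pairing x (a x) (b x) = C.pairing x (a x) (s.toFun x (C.anchor x (b x)))
    + C.pairing x (b x) (s.toFun x (C.anchor x (a x)))
  linarith

/-- By `inner_eq`, the pairing of a section with any other depends only on its vector field and its
1-form, and the pairing is nondegenerate. -/
lemma sec_ext (hC : C.IsExact) {a b : Sec E F V} (h : C.rho a = C.rho b)
    (h' : ∀ v, C.inner a (s.map v) = C.inner b (s.map v)) : a = b := by
  refine C.sec_ext_of_inner fun e => ?_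
  rw [s.inner_eq hC a, s.inner_eq hC b, h, h']

variable {s} {Ω : DiffForm E M 3}

/-- Isotropy removes the symmetric part of the Dorfman bracket, leaving the Courant bracket. Its
1-form is the curvature and its vector field is `[a, b]`; `inner_eq` combines the two. -/
lemma HasCurvature.inner_dorfman_map_map (hs : s.HasCurvature (-Ω)) (hC : C.IsExact)
    (a b : VF E M) (e : Sec E F V) : C.inner (C.dorfman (s.map a) (s.map b)) e =
      -Ω.eval ![a, b, C.rho e] + C.inner e (s.map ⁅a, b⁆) := by
  have h0 : C.D 0 = 0 := by simpa using C.D_smul 0 0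
  have h1 : C.dorfman (s.map a) (s.map b) = C.bracket (s.map a) (s.map b) := by
    rw [CourantAlgebroid.dorfman, inner_map_map, h0, smul_zero, add_zero]
  rw [h1, s.inner_eq hC, hs, DiffForm.neg_eval, C.rho_bracket, rho_map, rho_map]

/-- Moving `e` to the last slot by `K_cycle` costs two derivative terms. Together with the bracket
term of `inner_dorfman_map_map` they form the exterior derivative of the 1-form of `e`. The
vanishing of the right-hand side is the Hamiltonian condition. -/
lemma HasCurvature.inner_dorfman_map (hs : s.HasCurvature (-Ω)) (hC : C.IsExact)
    (e : Sec E F V) (a b : VF E M) : C.inner (C.dorfman e (s.map a)) (s.map b) =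
      -Ω.eval ![C.rho e, a, b] - (s.oneForm e).d ![a, b] := by
  have h := C.K_cycle e (s.map a) (s.map b)
  rw [hs.inner_dorfman_map_map hC, rho_map, rho_map] at h
  rw [DiffForm.d_one]
  simp only [oneForm_eval]
  rw [Ω.eval_swap₁₂, Ω.eval_swap₀₁] at h
  linear_combination -h

/-- A section preserves the splitting if and only if its 1-form is Hamiltonian, with Hamiltonian
vector field its image under the anchor. -/
lemma HasCurvature.mem_preserving_iff (hs : s.HasCurvature (-Ω)) (hC : C.IsExact)
    {e : Sec E F V} : e ∈ s.preserving ↔ IsHamiltonianPair Ω (s.oneForm e) (C.rho e) := by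
  have hρ (v : VF E M) : C.rho (C.dorfman e (s.map v)) = C.rho (s.map ⁅C.rho e, v⁆) := by
    rw [CourantAlgebroid.dorfman, rho_add, rho_smul, C.rho_D, C.rho_bracket, rho_map, rho_map,
      smul_zero, add_zero]
  constructor
  · intro h u
    obtain ⟨a, b, rfl⟩ : ∃ a b, u = ![a, b] := ⟨u 0, u 1, by ext i; fin_cases i <;> rfl⟩
    have h1 := hs.inner_dorfman_map hC e a b
    rw [h a, inner_map_map] at h1
    rw [DiffForm.interior_eval]
    linear_combination h1
  · intro h v
    refine s.sec_ext hC (hρ v) fun w => ?_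
    rw [hs.inner_dorfman_map hC, inner_map_map, h, DiffForm.interior_eval]
    simp

/-- The section `s(v) + ρ^* α` has vector field `v`, and isotropy makes `α` its 1-form. This gives
surjectivity on homology in degree 0. -/
lemma HasCurvature.exists_mem_preserving (hs : s.HasCurvature (-Ω)) (hC : C.IsExact)
    {α : DiffForm E M 1} {v : VF E M} (h : IsHamiltonianPair Ω α v) :
    ∃ e ∈ s.preserving, C.rho e = v := by
  have hρ : C.rho (s.map v + C.coanchorSec α) = v := by
    rw [rho_add, rho_map, C.rho_coanchorSec hC, add_zero]
  refine ⟨s.map v + C.coanchorSec α, (hs.mem_preserving_iff hC).2 ?_, hρ⟩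
  have hα (w : VF E M) : (s.oneForm (s.map v + C.coanchorSec α)).eval ![w] = α.eval ![w] := by
    rw [oneForm_eval, pair_add_left, inner_map_map, C.inner_coanchorSec, rho_map, zero_add]
  rw [hρ, isHamiltonianPair_iff]
  rw [isHamiltonianPair_iff] at h
  simpa only [hα] using h

/-- The 1-form of `e` is Hamiltonian for the zero field, hence closed, hence `df`. Then `e` and `D
f` have the same 1-form and both have zero anchor. This gives injectivity on homology in degree 0.
-/
lemma HasCurvature.exists_D_eq [SimplyConnectedSpace M] (hs : s.HasCurvature (-Ω))
    (hC : C.IsExact) {e : Sec E F V} (he : e ∈ s.preserving) (h : C.rho e = 0) :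
    ∃ f, C.D f = e := by
  have h1 := (hs.mem_preserving_iff hC).1 he
  rw [h] at h1
  obtain ⟨f, hf⟩ := h1.isClosed.exists_primitive
  refine ⟨f, s.sec_ext hC (by rw [C.rho_D, h]) fun v => ?_⟩
  rw [inner_D, rho_map]
  ext x
  exact hf x (v x)

/-! ### The homotopy relating the Jacobiator to the curvature -/

variable (s)

/-- The bilinear map `(a, b) ↦ 1/2 (⟨b, s(ρ(a))⟩ - ⟨a, s(ρ(b))⟩)`. -/
def skewPairing : Sec E F V →ₗ[ℝ] Sec E F V →ₗ[ℝ] SmoothFn E M :=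
  LinearMap.mk₂ ℝ
    (fun a b => (1 / 2 : ℝ) • (C.inner b (s.map (C.rho a)) - C.inner a (s.map (C.rho b))))
    (fun a a' b => by
      rw [rho_add, map_add, pair_add_right, pair_add_left]; module)
    (fun r a b => by
      rw [rho_smul, map_smul, pair_smul_right, pair_smul_left]; module)
    (fun a b b' => by
      rw [rho_add, map_add, pair_add_right, pair_add_left]; module)
    (fun r a b => by
      rw [rho_smul, map_smul, pair_smul_right, pair_smul_left]; module)

lemma skewPairing_apply (a b : Sec E F V) : s.skewPairing a b =
    (1 / 2 : ℝ) • (C.inner b (s.map (C.rho a)) - C.inner a (s.map (C.rho b))) := rfl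

lemma skewPairing_swap (a b : Sec E F V) : s.skewPairing a b = -s.skewPairing b a := by
  rw [skewPairing_apply, skewPairing_apply]; module

/-- This is the homotopy condition in degree 1, since the right-hand side is the action of `e` on
`f`; it accounts for the factor `1/2` in the skew pairing. -/
lemma skewPairing_D (e : Sec E F V) (f : SmoothFn E M) :
    s.skewPairing e (C.D f) = (1 / 2 : ℝ) • C.inner e (C.D f) := by
  have h0 (a : Sec E F V) : C.inner a 0 = 0 := by simpa using C.pair_smul_right 0 a 0
  rw [skewPairing_apply, C.rho_D, map_zero, h0, inner_D, inner_D', rho_map, sub_zero]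

variable {s}

/-- By invariance of the pairing, the Dorfman bracket with a section preserving the splitting acts
on 1-forms as the Lie derivative along its vector field. -/
lemma inner_dorfman_map_of_mem {x : Sec E F V} (hx : x ∈ s.preserving) (y : Sec E F V)
    (w : VF E M) : C.inner (C.dorfman x y) (s.map w) =
      (C.rho x).deriv (C.inner y (s.map w)) - C.inner y (s.map ⁅C.rho x, w⁆) := by
  rw [C.invariance', hx w, add_sub_cancel_right]

/-- On sections preserving the splitting, `T` is cohomologous to the curvature. -/
lemma HasCurvature.T_add_eval (hs : s.HasCurvature (-Ω)) (hC : C.IsExact) {x y z : Sec E F V}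
    (hx : x ∈ s.preserving) (hy : y ∈ s.preserving) (hz : z ∈ s.preserving) :
    -C.T x y z + Ω.eval ![C.rho x, C.rho y, C.rho z] =
      s.skewPairing x (C.bracket y z) - s.skewPairing (C.bracket x y) z
        - s.skewPairing y (C.bracket x z) := by
  have ha := isHamiltonianPair_iff.1 ((hs.mem_preserving_iff hC).1 hx) (C.rho y) (C.rho z)
  have hb := isHamiltonianPair_iff.1 ((hs.mem_preserving_iff hC).1 hy) (C.rho x) (C.rho z)
  have hc := isHamiltonianPair_iff.1 ((hs.mem_preserving_iff hC).1 hz) (C.rho x) (C.rho y)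
  simp only [oneForm_eval] at ha hb hc
  rw [Ω.eval_swap₀₁] at hb
  rw [Ω.eval_swap₀₁, Ω.eval_swap₁₂, neg_neg] at hc
  have hd : C.inner (C.dorfman x y) z = (C.rho x).deriv (C.inner y (s.map (C.rho z)))
      - C.inner y (s.map ⁅C.rho x, C.rho z⁆) + C.inner z (s.map ⁅C.rho x, C.rho y⁆) := by
    have hρ : C.rho (C.dorfman x y) = ⁅C.rho x, C.rho y⁆ := by
      rw [CourantAlgebroid.dorfman, rho_add, rho_smul, C.rho_D, C.rho_bracket, smul_zero, add_zero]
    rw [s.inner_eq hC, hρ, inner_dorfman_map_of_mem hx]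
  have hsk : C.inner z (s.map ⁅C.rho y, C.rho x⁆) = -C.inner z (s.map ⁅C.rho x, C.rho y⁆) := by
    rw [← lie_skew, map_neg, pair_neg_right]
  rw [C.T_eq, hd]
  simp only [skewPairing_apply, C.inner_bracket, C.rho_bracket, rho_map,
    inner_dorfman_map_of_mem hx, inner_dorfman_map_of_mem hy]
  rw [hsk, s.inner_eq hC x y, s.inner_eq hC y z, s.inner_eq hC x z]
  simp only [VF.deriv_add]
  -- Everything is now expressed by the three 1-forms on the three vector fields. In the order `x,
  -- y, z`, the relations `ha`, `hb`, `hc` carry `Ω` with signs `+`, `-`, `+`, so these weights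
  -- leave `Ω` exactly once.
  linear_combination (norm := module) hc - (1 / 2 : ℝ) • hb - (1 / 2 : ℝ) • ha

end Splitting
end Splitting
-- The 3-cocycle of the 2-plectic form at a point
section Cocycle

variable {E : Type*} [NormedAddCommGroup E] [NormedSpace ℝ E] [FiniteDimensional ℝ E]
  {M : Type*} [TopologicalSpace M] [T2Space M] [ChartedSpace E M] [IsManifold 𝓘(ℝ, E) ∞ M]

lemma DiffForm.eval_add₁ (Ω : DiffForm E M 3) (a b b' c : VF E M) :
    Ω.eval ![a, b + b', c] = Ω.eval ![a, b, c] + Ω.eval ![a, b', c] := by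
  rw [Ω.eval_swap₀₁, DiffForm.eval_add₀, Ω.eval_swap₀₁ a b, Ω.eval_swap₀₁ a b', neg_add]

lemma DiffForm.eval_smul₁ (Ω : DiffForm E M 3) (r : ℝ) (a b c : VF E M) :
    Ω.eval ![a, r • b, c] = r • Ω.eval ![a, b, c] := by
  rw [Ω.eval_swap₀₁, DiffForm.eval_smul₀, Ω.eval_swap₀₁ a b, smul_neg]

lemma DiffForm.eval_add₂ (Ω : DiffForm E M 3) (a b c c' : VF E M) :
    Ω.eval ![a, b, c + c'] = Ω.eval ![a, b, c] + Ω.eval ![a, b, c'] := by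
  rw [Ω.eval_swap₁₂, DiffForm.eval_add₁, Ω.eval_swap₁₂ a b, Ω.eval_swap₁₂ a b, neg_add]

lemma DiffForm.eval_smul₂ (Ω : DiffForm E M 3) (r : ℝ) (a b c : VF E M) :
    Ω.eval ![a, b, r • c] = r • Ω.eval ![a, b, c] := by
  rw [Ω.eval_swap₁₂, DiffForm.eval_smul₁, Ω.eval_swap₁₂ a b, smul_neg]

variable (Ω : DiffForm E M 3) (hΩ : IsTwoPlectic Ω) (p : M)

/-- The Lie algebra cocycle `-Ω(u, v, w)(p)` on Hamiltonian vector fields. -/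
def hamCocycle : hamVF Ω hΩ →ₗ[ℝ] hamVF Ω hΩ →ₗ[ℝ] hamVF Ω hΩ →ₗ[ℝ] ℝ :=
  LinearMap.mk₂ ℝ
    (fun u v =>
      { toFun := fun w => -Ω.eval ![u, v, w] p
        map_add' := fun w w' => by
          rw [show ((w + w' : hamVF Ω hΩ) : VF E M) = w + w' from rfl, DiffForm.eval_add₂,
            ContMDiffMap.coe_add, Pi.add_apply, neg_add]
        map_smul' := fun r w => by
          rw [show ((r • w : hamVF Ω hΩ) : VF E M) = r • (w : VF E M) from rfl, DiffForm.eval_smul₂,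
            ContMDiffMap.coe_smul, Pi.smul_apply, smul_neg, RingHom.id_apply] })
    (fun u u' v => LinearMap.ext fun w =>
      show -Ω.eval ![(u : VF E M) + u', v, w] p = -_ + -_ by
        rw [DiffForm.eval_add₀, ContMDiffMap.coe_add, Pi.add_apply, neg_add])
    (fun r u v => LinearMap.ext fun w =>
      show -Ω.eval ![r • (u : VF E M), v, w] p = r • -_ by
        rw [DiffForm.eval_smul₀, ContMDiffMap.coe_smul, Pi.smul_apply, smul_neg])
    (fun u v v' => LinearMap.ext fun w =>
      show -Ω.eval ![(u : VF E M), v + v', w] p = -_ + -_ by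
        rw [DiffForm.eval_add₁, ContMDiffMap.coe_add, Pi.add_apply, neg_add])
    (fun r u v => LinearMap.ext fun w =>
      show -Ω.eval ![(u : VF E M), r • (v : VF E M), w] p = r • -_ by
        rw [DiffForm.eval_smul₁, ContMDiffMap.coe_smul, Pi.smul_apply, smul_neg])

lemma hamCocycle_apply (u v w : hamVF Ω hΩ) :
    hamCocycle Ω hΩ p u v w = -Ω.eval ![(u : VF E M), v, w] p := rfl

/-- The central extension of `𝔛_Ham(M)` by `b𝔲(1)` given by the value of `-Ω` at a point. -/
def hamExtension : Lie2Algebra :=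
  Lie2Algebra.ofCocycle (hamVF Ω hΩ) (hamCocycle Ω hΩ p)
    (fun x y z => by
      simp only [hamCocycle_apply]; rw [Ω.eval_swap₀₁]; rfl)
    (fun x y z => by
      simp only [hamCocycle_apply]; rw [Ω.eval_swap₁₂]; rfl)
    -- The cocycle identity is an equality of functions on `M`, so it may be evaluated at `p`. Its
    -- proof needs a potential for each of the four vector fields.
    (fun ⟨x, _, hx⟩ ⟨y, _, hy⟩ ⟨z, _, hz⟩ ⟨w, _, hw⟩ => by
      have h := congrArg (fun f : SmoothFn E M => -f p) (hΩ.closed.hamVF_cocycle hx hy hz hw)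
      simp only [ContMDiffMap.coe_add, Pi.add_apply, neg_add] at h
      exact h)

end Cocycle

/-! ### The quasi-isomorphism to the central extension -/

section QuasiIso

variable {E : Type*} [NormedAddCommGroup E] [NormedSpace ℝ E] [FiniteDimensional ℝ E]
  {M : Type*} [TopologicalSpace M] [T2Space M] [ChartedSpace E M] [IsManifold 𝓘(ℝ, E) ∞ M]
  {F : Type*} [NormedAddCommGroup F] [NormedSpace ℝ F] [FiniteDimensional ℝ F]
  {V : M → Type*} [TopologicalSpace (TotalSpace F V)]
  [∀ x, TopologicalSpace (V x)] [FiberBundle F V]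
  [∀ x, AddCommGroup (V x)] [∀ x, Module ℝ (V x)] [VectorBundle ℝ F V]
  [ContMDiffVectorBundle ∞ F V 𝓘(ℝ, E)]
  {C : CourantAlgebroid E F V} {s : Splitting C} {Ω : DiffForm E M 3}

open PreCourant Splitting

/-- The anchor as a map from sections preserving the splitting to Hamiltonian vector fields. -/
def preservingAnchor (hΩ : IsTwoPlectic Ω) (hC : C.IsExact) (hs : s.HasCurvature (-Ω)) :
    s.preserving →ₗ[ℝ] hamVF Ω hΩ where
  toFun e := ⟨C.rho e, _, (hs.mem_preserving_iff hC).1 e.2⟩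
  map_add' a b := Subtype.ext (C.rho_add a b)
  map_smul' r a := Subtype.ext (C.rho_smul r a)

/-- The morphism of Lie 2-algebras given by the anchor on sections and by the value at a point on
functions. -/
def preservingToHamExtension (hΩ : IsTwoPlectic Ω) (hC : C.IsExact) (hs : s.HasCurvature (-Ω))
    (p : M) : Lie2Hom (LInftyPreserving C s) (hamExtension Ω hΩ p) where
  φ0 := preservingAnchor hΩ hC hs
  φ1 := ({ toFun := fun f => f p, map_add' := fun _ _ => rfl, map_smul' := fun _ _ => rfl } :
    SmoothFn E M →ₗ[ℝ] ℝ)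
  Φ := (LinearMap.mk₂ ℝ (fun a b : s.preserving => s.skewPairing a b p)
    (fun a a' b => by
      rw [Submodule.coe_add, map_add, LinearMap.add_apply, ContMDiffMap.coe_add, Pi.add_apply])
    (fun r a b => by
      rw [Submodule.coe_smul, map_smul, LinearMap.smul_apply, ContMDiffMap.coe_smul,
        Pi.smul_apply])
    (fun a b b' => by rw [Submodule.coe_add, map_add, ContMDiffMap.coe_add, Pi.add_apply])
    (fun r a b => by rw [Submodule.coe_smul, map_smul, ContMDiffMap.coe_smul, Pi.smul_apply]) :
    s.preserving →ₗ[ℝ] s.preserving →ₗ[ℝ] ℝ)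
  comm f := (Subtype.ext (C.rho_D f) :
    preservingAnchor hΩ hC hs ⟨C.D f, s.D_mem_preserving f⟩ = 0).symm
  skew a b := congrArg (fun f : SmoothFn E M => f p) (s.skewPairing_swap a.1 b.1)
  -- The target has zero differential, so the degree-0 map has to preserve brackets strictly, as the
  -- anchor does.
  d_htpy a b := sub_eq_zero.2 (Subtype.ext (C.rho_bracket _ _))
  htpy_d e f := (sub_zero _).trans
    (congrArg (fun f : SmoothFn E M => f p) (s.skewPairing_D e.1 f).symm)
  coherence x y z := by
    have h := congrArg (fun f : SmoothFn E M => f p) (hs.T_add_eval hC x.2 y.2 z.2)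
    -- The trailing zeros are the actions in the target; without them, coherence is `T_add_eval` at
    -- `p`.
    change -C.T x.1 y.1 z.1 p - -Ω.eval ![C.rho x.1, C.rho y.1, C.rho z.1] p =
      s.skewPairing x.1 (C.bracket y.1 z.1) p - s.skewPairing (C.bracket x.1 y.1) z.1 p
        - s.skewPairing y.1 (C.bracket x.1 z.1) p - -0 + 0 - 0
    rw [neg_zero, sub_zero, add_zero, sub_zero, sub_neg_eq_add]
    exact h

lemma preservingToHamExtension_isQuasiIso [SimplyConnectedSpace M] (hΩ : IsTwoPlectic Ω)
    (hC : C.IsExact) (hs : s.HasCurvature (-Ω)) (p : M) :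
    (preservingToHamExtension hΩ hC hs p).IsQuasiIso := by
  -- Injectivity of `ρ^*` turns `D f = 0` into `df = 0`, so degree-1 cycles are constants and are
  -- determined by their value at `p`.
  have hker {f : SmoothFn E M} (h : C.D f = 0) (x : M) : f x = f p := by
    refine eq_of_dAt_eq_zero (fun y => ?_) x p
    have h1 : C.coanchor y (dAt f y).toLinearMap = 0 := congrArg (fun e : Sec E F V => e y) h
    have h2 := (hC y).1 (h1.trans (map_zero _).symm)
    exact ContinuousLinearMap.coe_injective h2
  refine ⟨⟨?_, ?_⟩, ?_, ?_⟩
  · rintro ⟨(f : SmoothFn E M), hf⟩ ⟨(g : SmoothFn E M), hg⟩ h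
    have hf' : C.D f = 0 := congrArg Subtype.val hf
    have hg' : C.D g = 0 := congrArg Subtype.val hg
    have h' : f p = g p := congrArg Subtype.val h
    refine Subtype.ext (ContMDiffMap.ext fun x => ?_)
    rw [hker hf', hker hg', h']
  · rintro ⟨(r : ℝ), hr⟩
    refine ⟨⟨(⟨fun _ => r, contMDiff_const⟩ : SmoothFn E M), Subtype.ext ?_⟩, Subtype.ext rfl⟩
    refine C.sec_ext_of_inner fun e => ?_
    have h0 : C.inner 0 e = 0 := by simpa using C.pair_smul_left 0 0 e
    refine (C.inner_D _ e).trans (Eq.trans ?_ h0.symm)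
    ext x
    change mvfderiv 𝓘(ℝ, E) (fun _ : M => r) x _ = 0
    rw [mvfderiv_const]
    rfl
  · rw [injective_iff_map_eq_zero]
    intro e
    obtain ⟨e, rfl⟩ := Submodule.Quotient.mk_surjective _ e
    intro h
    -- The differential of the target is zero, so a trivial class there means that the anchor of `e`
    -- vanishes.
    obtain ⟨r, hr⟩ := (Submodule.Quotient.mk_eq_zero _).1 h
    have h1 : C.rho e.1 = 0 := (congrArg Subtype.val hr).symm
    obtain ⟨f, hf⟩ := hs.exists_D_eq hC e.2 h1
    exact (Submodule.Quotient.mk_eq_zero _).2 ⟨f, Subtype.ext hf⟩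
  · intro v
    obtain ⟨⟨v, α, h⟩, rfl⟩ := Submodule.Quotient.mk_surjective _ v
    obtain ⟨e, he, hv⟩ := hs.exists_mem_preserving hC h
    refine ⟨Submodule.Quotient.mk (⟨e, he⟩ : s.preserving), ?_⟩
    exact congrArg Submodule.Quotient.mk (Subtype.ext hv)

end QuasiIso

end TwoPlectic
end

theorem mainTheorem4
    {E : Type uE} [NormedAddCommGroup E] [NormedSpace ℝ E] [FiniteDimensional ℝ E]
    {M : Type uM} [TopologicalSpace M] [T2Space M] [SecondCountableTopology M]
    [ChartedSpace E M] [IsManifold 𝓘(ℝ, E) ∞ M] [SimplyConnectedSpace M]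
    (Ω : TwoPlectic.DiffForm E M 3) (hΩ : TwoPlectic.IsTwoPlectic Ω)
    {F : Type uF} [NormedAddCommGroup F] [NormedSpace ℝ F] [FiniteDimensional ℝ F]
    {V : M → Type uV} [TopologicalSpace (Bundle.TotalSpace F V)]
    [∀ x, TopologicalSpace (V x)] [FiberBundle F V]
    [∀ x, AddCommGroup (V x)] [∀ x, Module ℝ (V x)] [VectorBundle ℝ F V]
    [ContMDiffVectorBundle ∞ F V 𝓘(ℝ, E)]
    (C : TwoPlectic.CourantAlgebroid E F V) (hC : C.IsExact)
    (s : TwoPlectic.Splitting C) (hs : s.HasCurvature (-Ω)) :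
    ∃ L' : TwoPlectic.Lie2Algebra.{max uE uM, 0},
      TwoPlectic.IsCentralExtension TwoPlectic.bu1 L'
        (TwoPlectic.Lie2Algebra.trivial (TwoPlectic.hamVF Ω hΩ)) ∧
      TwoPlectic.QuasiIsomorphic (TwoPlectic.LInftyPreserving C s) L' := by
  -- Any base point will do; a simply connected space is nonempty.
  obtain ⟨p⟩ : Nonempty M := inferInstance
  exact ⟨TwoPlectic.hamExtension Ω hΩ p, TwoPlectic.Lie2Algebra.isCentralExtension_ofCocycle ..,
    _, TwoPlectic.preservingToHamExtension_isQuasiIso hΩ hC hs p⟩
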